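/- All graphs are finite and simple. An articulation point of a graph is a vertex whose removal increases the number of connected components; a block is a maximal connected subgraph that has no articulation point of its own. The BC-tree $\mathfrak G$ of a graph $G$ has one vertex $\mathfrak a$ for each articulation point $a$ and one vertex $\mathfrak B$ for each block $B$, with an edge $[\mathfrak a,\mathfrak B]$ whenever $a\in B$. The articulation components of $G$ at an articulation point $a$ (respectively, at a block $B$) are the subgraphs obtained from the connected components of $\mathfrak G-\mathfrak a$ (respectively, $\mathfrak G-\mathfrak B$) by taking the union of all blocks belonging to the component; at a vertex that is not an articulation point there are none. Let $d$ be the graph distance, and let $\mathrm{ecc}(v)=\max_u d(u,v)$, $\mathrm{rad}(G)=\min_v\mathrm{ecc}(v)$ and $\mathrm{diam}(G)=\max_v\mathrm{ecc}(v)$; central points are vertices with $\mathrm{ecc}(v)=\mathrm{rad}(G)$ and peripheral vertices are those with $\mathrm{ecc}(v)=\mathrm{diam}(G)$. For a block $B$ let $d(B,v)=\min_{u\in B}d(u,v)$ and $\mathrm{ecc}(B)=\max_{v\in V(G)}d(B,v)$; the block radius is $\mathrm{brad}(G)=\min_B\mathrm{ecc}(B)$, and central blocks are the blocks attaining it. Let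 $G$ be a connected graph. Construct a pruned subgraph $G'$ as follows. If $\mathrm{brad}(G)=\mathrm{rad}(G)$ (type A), let $R=\{a\}$ with $a$ the central point of $G$, and let $\{G_i\}$ be the articulation components at $a$; if $\mathrm{brad}(G)\ne\mathrm{rad}(G)$ (type B), let $R=B$ be the central block of $G$, and let $\{G_i\}$ be the articulation components at $B$. For each $i$ choose a vertex of $G_i$ of maximal distance from $R$ and a geodesic from it to $R$. Then $G'$ is the union of $R$, these geodesics, and all blocks of $G$ that contain at least one edge of one of these geodesics. **Theorem.** Such a $G'$ exists, and for every $G'$ obtained in this way: 1. $G'$ is a connected subgraph of $G$. 2. The BC-tree of $G'$ is a subgraph of the BC-tree of $G$: the articulation points and blocks of $G'$ are articulation points and blocks of $G$, with the same incidences. 3. The BC-tree of $G'$ is a path (possibly a single vertex) or a starlike tree, i.e. a tree with exactly one vertex of degree greater than $2$. 4. $G'$ has the same central points, the same central blocks, the same radius and the same block radius as $G$. 5. The peripheral vertices of $G'$ are a subset of the peripheral vertices of $G$, and $\mathrm{diam}(G')=\mathrm{diam}(G)$. -/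

import Mathlib

namespace SimpleGraph

variable {V : Type*}

/-- A vertex of a (finite) graph is an articulation point if its removal increases the number of
connected components. -/
def IsArticulationPoint (G : SimpleGraph V) (a : V) : Prop :=
  Nat.card G.ConnectedComponent < Nat.card (G.induce {a}ᶜ).ConnectedComponent

/-- A graph is nonseparable if it is connected and has no articulation points. -/
def IsNonseparable (G : SimpleGraph V) : Prop :=
  G.Connected ∧ ∀ a, ¬ G.IsArticulationPoint a

/-- A block of `G` is a maximal nonseparable subgraph of `G`. -/
def IsBlock (G : SimpleGraph V) (B : G.Subgraph) : Prop :=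
  Maximal (fun H : G.Subgraph => H.coe.IsNonseparable) B

/-- The vertices of the BC-tree: one for each articulation point and one for each block. -/
abbrev BCVertex (G : SimpleGraph V) :=
  {a : V // G.IsArticulationPoint a} ⊕ {B : G.Subgraph // G.IsBlock B}

/-- The block-cutpoint tree: an articulation point is joined to the blocks containing it. -/
def bcTree (G : SimpleGraph V) : SimpleGraph G.BCVertex where
  Adj
    | .inl a, .inr B => a.1 ∈ B.1.verts
    | .inr B, .inl a => a.1 ∈ B.1.verts
    | _, _ => False
  symm := ⟨by rintro (a | B) (a' | B') h <;> exact h⟩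
  loopless := ⟨by rintro (a | B) h <;> exact h⟩

/-- The shadow in `G` of a set of vertices of the BC-tree: the union of the blocks in it. -/
def shadow (G : SimpleGraph V) (S : Set G.BCVertex) : G.Subgraph :=
  sSup {B | ∃ h : G.IsBlock B, Sum.inr ⟨B, h⟩ ∈ S}

/-- The shadows of the connected components of the BC-tree with the vertex `x` removed. -/
def articulationComponents (G : SimpleGraph V) (x : G.BCVertex) : Set G.Subgraph :=
  Set.range fun c : (G.bcTree.induce {x}ᶜ).ConnectedComponent => G.shadow (Subtype.val '' c.supp)

/-- The articulation components at an articulation point `a`. (There are none if `a` is not an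
articulation point.) -/
def articulationComponentsAtPoint (G : SimpleGraph V) (a : V) : Set G.Subgraph :=
  {H | ∃ h : G.IsArticulationPoint a, H ∈ G.articulationComponents (.inl ⟨a, h⟩)}

/-- The articulation components at a block `B`. -/
def articulationComponentsAtBlock (G : SimpleGraph V) (B : G.Subgraph) : Set G.Subgraph :=
  {H | ∃ h : G.IsBlock B, H ∈ G.articulationComponents (.inr ⟨B, h⟩)}

/-- The distance from a subgraph `B` (a block, or a single vertex) to a vertex `v`. -/
noncomputable def distTo (G : SimpleGraph V) (B : G.Subgraph) (v : V) : ℕ∞ :=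
  ⨅ u ∈ B.verts, G.edist u v

/-- The eccentricity of a block. -/
noncomputable def blockEccent (G : SimpleGraph V) (B : G.Subgraph) : ℕ∞ :=
  ⨆ v, G.distTo B v

/-- The block radius: the minimal eccentricity of a block. -/
noncomputable def blockRadius (G : SimpleGraph V) : ℕ∞ :=
  ⨅ B ∈ {B : G.Subgraph | G.IsBlock B}, G.blockEccent B

/-- The central blocks: the blocks of minimal eccentricity. -/
def centralBlocks (G : SimpleGraph V) : Set G.Subgraph :=
  {B | G.IsBlock B ∧ G.blockEccent B = G.blockRadius}

/-- The periphery: the vertices whose eccentricity is the diameter. -/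
def periphery (G : SimpleGraph V) : Set V :=
  {v | G.eccent v = G.ediam}

/-- Type A: block radius and vertex radius agree. Type B: they do not. -/
def IsTypeA (G : SimpleGraph V) : Prop :=
  G.blockRadius = G.radius

/-- `G'` consists of the subgraph `R` together with, for each of the subgraphs `H ∈ comps`, a
geodesic to `R` from a vertex `far H` of `H` of maximal distance from `R`, and all blocks of `G`
containing at least one edge of this geodesic. -/
def IsPrunedAlong (G : SimpleGraph V) (R : G.Subgraph) (comps : Set G.Subgraph)
    (G' : G.Subgraph) : Prop :=
  ∃ (far near : comps → V) (p : ∀ H : comps, G.Walk (far H) (near H)),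
    (∀ H : comps, far H ∈ H.1.verts ∧ ∀ v ∈ H.1.verts, G.distTo R v ≤ G.distTo R (far H)) ∧
    (∀ H : comps, near H ∈ R.verts ∧ ((p H).length : ℕ∞) = G.distTo R (far H)) ∧
    G' = R ⊔ ⨆ H : comps, ((p H).toSubgraph ⊔
      sSup {D : G.Subgraph | G.IsBlock D ∧ ∃ e ∈ (p H).edges, e ∈ D.edgeSet})

/-- `G'` is a result of pruning `G`: for type A, at the central point; for type B, at the central
block. -/
def IsPruning (G : SimpleGraph V) (G' : G.Subgraph) : Prop :=
  (G.IsTypeA ∧ ∃ a ∈ G.center,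
    G.IsPrunedAlong (G.singletonSubgraph a) (G.articulationComponentsAtPoint a) G') ∨
  (¬ G.IsTypeA ∧ ∃ B ∈ G.centralBlocks,
    G.IsPrunedAlong B (G.articulationComponentsAtBlock B) G')

/-- The graph is a path with at least one vertex. -/
def IsPathShaped (T : SimpleGraph V) : Prop :=
  ∃ n : ℕ, Nonempty (T ≃g pathGraph (n + 1))

/-- A starlike tree: a tree with exactly one vertex of degree greater than 2. -/
def IsStarlike (T : SimpleGraph V) : Prop :=
  T.IsTree ∧ ∃! v, 2 < (T.neighborSet v).encard

/-- The BC-tree of the subgraph `G'` is a subgraph of the BC-tree of `G`: articulation points and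
blocks of `G'` are articulation points and blocks of `G`, and this identification of vertices
preserves adjacency. -/
def BCTreeIsSubgraph (G : SimpleGraph V) (G' : G.Subgraph) : Prop :=
  ∃ f : G'.coe.bcTree →g G.bcTree, Function.Injective f ∧
    (∀ a : {a : G'.verts // G'.coe.IsArticulationPoint a},
      ∃ h : G.IsArticulationPoint (a.1 : V), f (Sum.inl a) = Sum.inl ⟨(a.1 : V), h⟩) ∧
    (∀ B : {B : G'.coe.Subgraph // G'.coe.IsBlock B},
      ∃ h : G.IsBlock (Subgraph.coeSubgraph B.1),
        f (Sum.inr B) = Sum.inr ⟨Subgraph.coeSubgraph B.1, h⟩)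

end SimpleGraph

/-! ### Separation by a single vertex; blocks as maximal linked sets. -/

namespace SimpleGraph

variable {V : Type*} {G : SimpleGraph V}

/-! The main tool is the gate. If `S` is path-convex, every walk from `v` to a vertex of `S` passes
through the vertex of `S` nearest to `v` (`gate_mem_support`). Hence distances add up along gates,
and a path uses an edge inside `S` exactly when its two ends have different gates in `S`. Blocks fit
this scheme: they are the induced subgraphs on maximal sets of vertices that no third vertex
separates (`isBlock_iff`), and such sets are path-convex.

The pruned graph is a connected union of blocks of `G`. Any path of `G` between two of its vertices
stays in it, since a walk inside the union must use the same blocks. So it is isometric in `G`, and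
its blocks and articulation points are blocks and articulation points of `G`; this embeds its
BC-tree.

The BC-tree is branched at most at the root because every articulation component contributes a
single geodesic. At any other vertex of the tree, at most one neighbour leads to the root and at
most one leads away (`Pruning.bcVertexMap_eq`). A finite tree with at most one vertex of degree
greater than 2 is a path or starlike.

The metric data rest on two criteria. In type A, equality of the radii yields two vertices at
distance `r = rad` from `a` that are separated by `a`. Such a pair of poles already forces the
centre to be `{a}`, the diameter to be `2 * r`, and the central blocks to be those through `a`
(`center_of_bipolar`). The farthest vertices retained by the pruning provide such poles again. In
type B, every vertex of `B` has larger eccentricity than `B` itself, so `B` is the only central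
block and contains the centre (`center_subset_of_isBlock`). Every vertex of `G` is dominated by a
retained vertex with the same gate in `B`, so eccentricities on `B` and the diameter survive. -/

/-- Some walk from `u` to `v` does not pass through `x`. -/
def ConnAvoiding (G : SimpleGraph V) (x u v : V) : Prop :=
  ∃ p : G.Walk u v, x ∉ p.support

theorem ConnAvoiding.symm {x u v : V} (h : G.ConnAvoiding x u v) : G.ConnAvoiding x v u := by
  obtain ⟨p, hp⟩ := h
  exact ⟨p.reverse, by simpa using hp⟩

theorem ConnAvoiding.trans {x u v w : V} (h : G.ConnAvoiding x u v) (h' : G.ConnAvoiding x v w) :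
    G.ConnAvoiding x u w := by
  obtain ⟨p, hp⟩ := h
  obtain ⟨q, hq⟩ := h'
  exact ⟨p.append q, by simp [Walk.mem_support_append_iff, hp, hq]⟩

theorem ConnAvoiding.refl {x u : V} (h : x ≠ u) : G.ConnAvoiding x u u :=
  ⟨.nil, by simpa using h⟩

theorem ConnAvoiding.exists_isPath {x u v : V} (h : G.ConnAvoiding x u v) :
    ∃ p : G.Walk u v, p.IsPath ∧ x ∉ p.support := by
  classical
  obtain ⟨p, hp⟩ := h
  exact ⟨p.bypass, p.bypass_isPath, fun h => hp (p.support_bypass_subset_support h)⟩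

/-- No third vertex separates `u` from `v`. -/
def Linked (G : SimpleGraph V) (u v : V) : Prop :=
  ∀ x, x ≠ u → x ≠ v → G.ConnAvoiding x u v

theorem Linked.symm {u v : V} (h : G.Linked u v) : G.Linked v u :=
  fun x hv hu => (h x hu hv).symm

theorem Linked.refl (u : V) : G.Linked u u := fun _ hx _ => .refl hx

theorem Adj.linked {u v : V} (h : G.Adj u v) : G.Linked u v := by
  intro x hu hv
  exact ⟨.cons h .nil, by simp [hu, hv]⟩

/-- Paths between vertices of `S` stay in `S`. -/
def PathConvex (G : SimpleGraph V) (S : Set V) : Prop :=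
  ∀ u ∈ S, ∀ v ∈ S, ∀ p : G.Walk u v, p.IsPath → ∀ w ∈ p.support, w ∈ S

theorem Walk.IsPath.eq_of_mem_takeUntil_dropUntil [DecidableEq V] {u v w x : V} {p : G.Walk u v}
    (hp : p.IsPath) (hw : w ∈ p.support) (h1 : x ∈ (p.takeUntil w hw).support)
    (h2 : x ∈ (p.dropUntil w hw).support) : x = w := by
  by_contra hne
  have hn := hp.support_nodup
  have hs := congrArg Walk.support (p.take_spec hw)
  rw [Walk.support_append] at hs
  rw [← hs] at hn
  have h3 : x ∈ (p.dropUntil w hw).support.tail :=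
    ((Walk.mem_support_iff _).1 h2).resolve_left hne
  exact List.disjoint_of_nodup_append hn h1 h3

/-- A maximal set of pairwise linked vertices. -/
structure IsMaxLinked (G : SimpleGraph V) (S : Set V) : Prop where
  linked : ∀ u ∈ S, ∀ v ∈ S, G.Linked u v
  mem : ∀ w, (∀ u ∈ S, G.Linked w u) → w ∈ S

/-- A vertex `x ≠ w` lies on at most one of the two pieces into which `w` cuts the path. The other
piece joins `w` to an end of the path while avoiding `x`, and that end is linked to all of `S`;
maximality then puts `w` in `S`. -/
theorem IsMaxLinked.pathConvex {S : Set V} (hS : G.IsMaxLinked S) : G.PathConvex S := by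
  classical
  intro u hu v hv p hp w hw
  refine hS.mem w fun s hs x hxw hxs => ?_
  by_cases h1 : x ∈ (p.takeUntil w hw).support
  · have h2 : x ∉ (p.dropUntil w hw).support := fun h2 =>
      hxw (hp.eq_of_mem_takeUntil_dropUntil hw h1 h2)
    have hxv : x ≠ v := by rintro rfl; exact h2 (Walk.end_mem_support _)
    exact ConnAvoiding.trans ⟨_, h2⟩ (hS.linked v hv s hs x hxv hxs)
  · have hxu : x ≠ u := by rintro rfl; exact h1 (Walk.start_mem_support _)
    exact ConnAvoiding.trans (ConnAvoiding.symm ⟨_, h1⟩) (hS.linked u hu s hs x hxu hxs)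

theorem exists_isMaxLinked [Finite V] {S : Set V} (hS : ∀ u ∈ S, ∀ v ∈ S, G.Linked u v) :
    ∃ T, S ⊆ T ∧ G.IsMaxLinked T := by
  obtain ⟨T, hST, hT⟩ := Set.Finite.exists_le_maximal
    (Set.toFinite {T : Set V | ∀ u ∈ T, ∀ v ∈ T, G.Linked u v}) hS
  refine ⟨T, hST, hT.prop, fun w hw => ?_⟩
  have : insert w T ⊆ T := by
    refine hT.le_of_ge ?_ (Set.subset_insert w T)
    rintro u (rfl | hu) v (rfl | hv)
    · exact .refl _
    · exact hw v hv
    · exact (hw u hu).symm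
    · exact hT.prop u hu v hv
  exact this (Set.mem_insert w T)

theorem connAvoiding_iff_reachable_induce {a u v : V} (hu : u ∈ ({a}ᶜ : Set V))
    (hv : v ∈ ({a}ᶜ : Set V)) :
    G.ConnAvoiding a u v ↔ (G.induce {a}ᶜ).Reachable ⟨u, hu⟩ ⟨v, hv⟩ := by
  constructor
  · rintro ⟨p, hp⟩
    exact ⟨p.induce _ fun x hx => by rintro rfl; exact hp hx⟩
  · rintro ⟨p⟩
    refine ⟨p.map (Embedding.induce _).toHom, ?_⟩
    intro h
    obtain ⟨⟨y, hy⟩, -, hya⟩ := List.mem_map.1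
      (Eq.mp (congrArg (a ∈ ·) (Walk.support_map (Embedding.induce _).toHom p)) h)
    exact hy hya

theorem isArticulationPoint_iff [Finite V] (hG : G.Connected) {a : V} :
    G.IsArticulationPoint a ↔ ∃ u v, u ≠ a ∧ v ≠ a ∧ ¬ G.ConnAvoiding a u v := by
  have h1 : Nat.card G.ConnectedComponent = 1 := by
    have := hG.preconnected.subsingleton_connectedComponent
    have := hG.nonempty
    have : Nonempty G.ConnectedComponent := hG.nonempty.map G.connectedComponentMk
    exact Nat.card_eq_one_iff_unique.2 ⟨inferInstance, inferInstance⟩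
  rw [IsArticulationPoint, h1, Finite.one_lt_card_iff_nontrivial]
  constructor
  · rintro ⟨c, d, hcd⟩
    induction c using ConnectedComponent.ind with | _ u
    induction d using ConnectedComponent.ind with | _ v
    refine ⟨u.1, v.1, u.2, v.2, fun h => hcd ?_⟩
    rw [connAvoiding_iff_reachable_induce u.2 v.2] at h
    exact ConnectedComponent.sound h
  · rintro ⟨u, v, hu, hv, h⟩
    rw [connAvoiding_iff_reachable_induce hu hv] at h
    exact ⟨_, _, fun h' => h (ConnectedComponent.exact h')⟩

theorem isNonseparable_iff [Finite V] :
    G.IsNonseparable ↔ G.Connected ∧ ∀ u v, G.Linked u v := by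
  constructor
  · rintro ⟨hG, h⟩
    refine ⟨hG, fun u v x hu hv => ?_⟩
    have := h x
    rw [isArticulationPoint_iff hG] at this
    by_contra hc
    exact this ⟨u, v, hu.symm, hv.symm, hc⟩
  · rintro ⟨hG, h⟩
    refine ⟨hG, fun a => ?_⟩
    rw [isArticulationPoint_iff hG]
    rintro ⟨u, v, hu, hv, hc⟩
    exact hc (h u v a hu.symm hv.symm)

namespace Subgraph

theorem exists_coe_walk {H : G.Subgraph} {u v : V} (q : G.Walk u v) (h : q.toSubgraph ≤ H) :
    ∃ q' : H.coe.Walk ⟨u, h.1 q.start_mem_verts_toSubgraph⟩ ⟨v, h.1 q.end_mem_verts_toSubgraph⟩,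
      q'.map H.hom = q := by
  refine ⟨q.mapToSubgraph.map (inclusion h), ?_⟩
  exact (Walk.map_map _ _ _).trans q.map_mapToSubgraph_hom

theorem mem_of_mem_support_map_hom {H : G.Subgraph} {u v : H.verts} (p : H.coe.Walk u v) {x : V}
    (hx : x ∈ (p.map H.hom).support) : ∃ h : x ∈ H.verts, ⟨x, h⟩ ∈ p.support := by
  rw [Walk.support_map] at hx
  obtain ⟨y, hy, rfl⟩ := List.mem_map.1 hx
  exact ⟨y.2, hy⟩

theorem mem_support_map_hom {H : G.Subgraph} {u v : H.verts} (p : H.coe.Walk u v) {x : H.verts} :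
    x.1 ∈ (p.map H.hom).support ↔ x ∈ p.support := by
  constructor
  · intro h
    exact (mem_of_mem_support_map_hom p h).2
  · intro h
    rw [Walk.support_map]
    exact List.mem_map.2 ⟨x, h, rfl⟩

/-- A separating vertex inside `H` would be an articulation point of `H`; one outside `H` is avoided
by any walk of the connected graph `H`. -/
theorem linked_of_isNonseparable [Finite V] {H : G.Subgraph} (hH : H.coe.IsNonseparable) {u v : V}
    (hu : u ∈ H.verts) (hv : v ∈ H.verts) : G.Linked u v := by
  rw [isNonseparable_iff] at hH
  intro x hxu hxv
  by_cases hx : x ∈ H.verts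
  · obtain ⟨p, hp⟩ := hH.2 ⟨u, hu⟩ ⟨v, hv⟩ ⟨x, hx⟩ (by simpa using hxu) (by simpa using hxv)
    exact ⟨p.map H.hom, fun h => hp ((mem_support_map_hom p (x := ⟨x, hx⟩)).1 h)⟩
  · obtain ⟨p⟩ := hH.1.preconnected ⟨u, hu⟩ ⟨v, hv⟩
    exact ⟨p.map H.hom, fun h => hx (mem_of_mem_support_map_hom p h).1⟩

theorem toSubgraph_le_induce {S : Set V} {u v : V} (p : G.Walk u v) (h : ∀ w ∈ p.support, w ∈ S) :
    p.toSubgraph ≤ (⊤ : G.Subgraph).induce S :=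
  p.toSubgraph_le_induce_support.trans (Subgraph.induce_mono_right h)

end Subgraph

theorem IsMaxLinked.isNonseparable [Finite V] (hG : G.Connected) {S : Set V}
    (hS : G.IsMaxLinked S) (hne : S.Nonempty) :
    ((⊤ : G.Subgraph).induce S).coe.IsNonseparable := by
  rw [isNonseparable_iff]
  constructor
  · rw [← Subgraph.connected_iff', Subgraph.connected_iff_forall_exists_walk_subgraph]
    refine ⟨hne, fun {u v} hu hv => ?_⟩
    obtain ⟨p, hp⟩ := hG.exists_isPath u v
    exact ⟨p, Subgraph.toSubgraph_le_induce p (hS.pathConvex u hu v hv p hp)⟩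
  · rintro ⟨u, hu⟩ ⟨v, hv⟩ ⟨x, hx⟩ hxu hxv
    obtain ⟨p, hp, hxp⟩ := (hS.linked u hu v hv x (by simpa using hxu)
      (by simpa using hxv)).exists_isPath
    obtain ⟨q, hq⟩ := Subgraph.exists_coe_walk p
      (Subgraph.toSubgraph_le_induce p (hS.pathConvex u hu v hv p hp))
    refine ⟨q, fun h => hxp ?_⟩
    rw [← hq]
    exact (Subgraph.mem_support_map_hom q).2 h

/-- The vertices of a nonseparable subgraph are pairwise linked, so they extend to a maximal linked
set. By path-convexity the subgraph induced on that set is again nonseparable, hence the two notions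
of maximality agree. -/
theorem isBlock_iff [Finite V] (hG : G.Connected) {B : G.Subgraph} :
    G.IsBlock B ↔ ∃ S : Set V, S.Nonempty ∧ G.IsMaxLinked S ∧ B = (⊤ : G.Subgraph).induce S := by
  have hle : ∀ H : G.Subgraph, ∀ S, H.verts ⊆ S → H ≤ (⊤ : G.Subgraph).induce S := by
    intro H S h
    refine ⟨h, fun u v huv => ?_⟩
    simp only [Subgraph.induce_adj, Subgraph.top_adj]
    exact ⟨h (H.edge_vert huv), h (H.edge_vert huv.symm), huv.adj_sub⟩
  constructor
  · intro hB
    have hne : B.verts.Nonempty := by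
      obtain ⟨x⟩ := (isNonseparable_iff.1 hB.prop).1.nonempty
      exact ⟨x.1, x.2⟩
    obtain ⟨T, hT, hTm⟩ := exists_isMaxLinked (S := B.verts)
      fun u hu v hv => Subgraph.linked_of_isNonseparable hB.prop hu hv
    have := hB.eq_of_le (hTm.isNonseparable hG (hne.mono hT)) (hle B T hT)
    exact ⟨T, hne.mono hT, hTm, this⟩
  · rintro ⟨S, hne, hS, rfl⟩
    refine ⟨hS.isNonseparable hG hne, fun H hH hSH => ?_⟩
    refine hle H S fun w hw => hS.mem w fun u hu => ?_
    exact Subgraph.linked_of_isNonseparable hH hw (hSH.1 hu)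

theorem IsBlock.isMaxLinked [Finite V] (hG : G.Connected) {B : G.Subgraph} (hB : G.IsBlock B) :
    G.IsMaxLinked B.verts := by
  obtain ⟨S, -, hS, rfl⟩ := (isBlock_iff hG).1 hB
  exact hS

theorem IsBlock.nonempty [Finite V] {B : G.Subgraph} (hB : G.IsBlock B) : B.verts.Nonempty := by
  obtain ⟨x⟩ := (isNonseparable_iff.1 hB.prop).1.nonempty
  exact ⟨x.1, x.2⟩

theorem IsBlock.adj_iff [Finite V] (hG : G.Connected) {B : G.Subgraph} (hB : G.IsBlock B)
    {u v : V} : B.Adj u v ↔ u ∈ B.verts ∧ v ∈ B.verts ∧ G.Adj u v := by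
  obtain ⟨S, -, hS, rfl⟩ := (isBlock_iff hG).1 hB
  simp

theorem IsBlock.eq_of_verts_eq [Finite V] (hG : G.Connected) {B B' : G.Subgraph}
    (hB : G.IsBlock B) (hB' : G.IsBlock B') (h : B.verts = B'.verts) : B = B' := by
  obtain ⟨S, -, hS, rfl⟩ := (isBlock_iff hG).1 hB
  obtain ⟨S', -, hS', rfl⟩ := (isBlock_iff hG).1 hB'
  simp only [Subgraph.induce_verts] at h
  rw [h]

theorem IsBlock.eq_of_verts_subset [Finite V] (hG : G.Connected) {B B' : G.Subgraph}
    (hB : G.IsBlock B) (hB' : G.IsBlock B') (h : B.verts ⊆ B'.verts) : B = B' := by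
  refine hB.eq_of_verts_eq hG hB' (h.antisymm fun w hw => ?_)
  exact (hB.isMaxLinked hG).mem w fun u hu => (hB'.isMaxLinked hG).linked w hw u (h hu)

theorem exists_isBlock_of_linked [Finite V] (hG : G.Connected) {u v : V} (h : G.Linked u v) :
    ∃ B, G.IsBlock B ∧ u ∈ B.verts ∧ v ∈ B.verts := by
  obtain ⟨T, hT, hTm⟩ := exists_isMaxLinked (G := G) (S := {u, v}) (by
    rintro x (rfl | rfl) y (rfl | rfl)
    · exact .refl _
    · exact h
    · exact h.symm
    · exact .refl _)
  exact ⟨_, (isBlock_iff hG).2 ⟨T, ⟨u, hT (by simp)⟩, hTm, rfl⟩, hT (by simp), hT (by simp)⟩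

theorem IsBlock.pathConvex [Finite V] (hG : G.Connected) {B : G.Subgraph} (hB : G.IsBlock B) :
    G.PathConvex B.verts :=
  (hB.isMaxLinked hG).pathConvex

theorem IsBlock.linked [Finite V] (hG : G.Connected) {B : G.Subgraph} (hB : G.IsBlock B) {u v : V}
    (hu : u ∈ B.verts) (hv : v ∈ B.verts) : G.Linked u v :=
  (hB.isMaxLinked hG).linked u hu v hv

/-- Distinct blocks have at most one common vertex. -/
theorem IsBlock.eq_of_mem_of_mem [Finite V] (hG : G.Connected) {B B' : G.Subgraph}
    (hB : G.IsBlock B) (hB' : G.IsBlock B') {u v : V} (huv : u ≠ v) (hu : u ∈ B.verts)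
    (hv : v ∈ B.verts) (hu' : u ∈ B'.verts) (hv' : v ∈ B'.verts) : B = B' := by
  refine hB.eq_of_verts_subset hG hB' fun w hw => (hB'.isMaxLinked hG).mem w fun s hs x hxw hxs => ?_
  by_cases hxu : x = u
  · have hxv : x ≠ v := hxu ▸ huv
    exact (hB.linked hG hw hv x hxw hxv).trans (hB'.linked hG hv' hs x hxv hxs)
  · exact (hB.linked hG hw hu x hxw hxu).trans (hB'.linked hG hu' hs x hxu hxs)

theorem IsBlock.eq_of_adj [Finite V] (hG : G.Connected) {B B' : G.Subgraph}
    (hB : G.IsBlock B) (hB' : G.IsBlock B') {u v : V} (h : B.Adj u v) (h' : B'.Adj u v) : B = B' :=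
  hB.eq_of_mem_of_mem hG hB' h.ne (B.edge_vert h) (B.edge_vert h.symm) (B'.edge_vert h')
    (B'.edge_vert h'.symm)

/-- A block that is not the only one has a vertex different from `c`. -/
theorem IsBlock.exists_ne [Finite V] (hG : G.Connected) {B B' : G.Subgraph}
    (hB : G.IsBlock B) (hB' : G.IsBlock B') (hne : B ≠ B') {c : V} (hc : c ∈ B'.verts) :
    ∃ u ∈ B.verts, u ≠ c := by
  by_contra! h
  exact hne (hB.eq_of_verts_subset hG hB' fun u hu => h u hu ▸ hc)

end SimpleGraph

/-! ### Gates: nearest vertices in path-convex sets. -/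

namespace SimpleGraph

variable {V : Type*} {G : SimpleGraph V}

open Classical in
/-- A vertex of `S` closest to `v`. -/
noncomputable def gate (G : SimpleGraph V) (S : Set V) (v : V) : V :=
  if h : S.Nonempty then Function.argminOn (G.dist v) S h else v

variable {S : Set V}

theorem gate_mem (hS : S.Nonempty) (v : V) : G.gate S v ∈ S := by
  rw [gate, dif_pos hS]
  exact Function.argminOn_mem _ _ _

theorem dist_gate_le {s : V} (hs : s ∈ S) (v : V) : G.dist v (G.gate S v) ≤ G.dist v s := by
  rw [gate, dif_pos ⟨s, hs⟩]
  exact Function.argminOn_le _ _ hs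

theorem exists_walk_gate (hG : G.Connected) (S : Set V) (v : V) :
    ∃ p : G.Walk v (G.gate S v), p.IsPath ∧ ∀ x ∈ p.support, x ∈ S → x = G.gate S v := by
  classical
  obtain ⟨p, hp, hl⟩ := hG.exists_path_of_dist v (G.gate S v)
  refine ⟨p, hp, fun x hx hxS => ?_⟩
  by_contra hne
  have h1 := Walk.length_takeUntil_lt_length hx hne
  have h2 := G.dist_le (p.takeUntil x hx)
  have h3 := G.dist_gate_le hxS v
  omega

/-- Go back from the gate to `v` along a geodesic `p`, then along `q`, and shorten to a path. By
convexity its first step leads to a vertex of `S`. That edge is not in `p`, which meets `S` only in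
the gate, so it is in `q`, and `q` visits the gate. -/
theorem gate_mem_support (hG : G.Connected) (hS : G.PathConvex S) {v s : V} (hs : s ∈ S)
    (q : G.Walk v s) : G.gate S v ∈ q.support := by
  classical
  by_contra hc
  obtain ⟨p, -, hp⟩ := exists_walk_gate hG S v
  have hg : G.gate S v ∈ S := gate_mem ⟨s, hs⟩ v
  have hb := (p.reverse.append q).bypass_isPath
  have hsub := (p.reverse.append q).edges_bypass_subset_edges
  generalize (p.reverse.append q).bypass = b at hb hsub
  cases b with
  | nil => exact hc (Walk.end_mem_support q)
  | @cons _ w _ hadj b' =>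
    have hw : w ∈ S := hS _ hg _ hs _ hb w (by simp)
    have he := hsub (show s(G.gate S v, w) ∈ (Walk.cons hadj b').edges by simp)
    rw [Walk.edges_append, List.mem_append, Walk.edges_reverse, List.mem_reverse] at he
    rcases he with he | he
    · exact hadj.ne (hp w (Walk.snd_mem_support_of_mem_edges _ he) hw).symm
    · exact hc (Walk.fst_mem_support_of_mem_edges _ he)

theorem gate_eq_of_walk (hG : G.Connected) (hS : G.PathConvex S) {v g : V} (hg : g ∈ S)
    (p : G.Walk v g) (hp : ∀ x ∈ p.support, x ∈ S → x = g) : G.gate S v = g :=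
  hp _ (gate_mem_support hG hS hg p) (gate_mem ⟨g, hg⟩ v)

theorem gate_of_mem (hG : G.Connected) (hS : G.PathConvex S) {v : V} (hv : v ∈ S) :
    G.gate S v = v :=
  gate_eq_of_walk hG hS hv .nil (by simp)

/-- Gates change only along edges inside `S`. This is what turns "uses an edge of a block" into a
comparison of gates. -/
theorem gate_eq_of_adj (hG : G.Connected) (hS : G.PathConvex S) (hne : S.Nonempty) {u v : V}
    (h : G.Adj u v) (huv : ¬ (u ∈ S ∧ v ∈ S)) : G.gate S u = G.gate S v := by
  by_cases hu : u ∈ S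
  · have hv : v ∉ S := fun hv => huv ⟨hu, hv⟩
    rw [gate_of_mem hG hS hu]
    refine (gate_eq_of_walk hG hS hu (.cons h.symm .nil) ?_).symm
    intro x hx hxS
    simp only [Walk.support_cons, Walk.support_nil, List.mem_cons, List.not_mem_nil,
      or_false] at hx
    rcases hx with rfl | rfl
    · exact absurd hxS hv
    · rfl
  · obtain ⟨p, -, hp⟩ := exists_walk_gate hG S v
    refine gate_eq_of_walk hG hS (gate_mem hne v) (.cons h p) ?_
    intro x hx hxS
    rw [Walk.support_cons, List.mem_cons] at hx
    rcases hx with rfl | hx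
    · exact absurd hxS hu
    · exact hp x hx hxS

theorem exists_mem_edges_of_gate_ne (hG : G.Connected) (hS : G.PathConvex S) (hne : S.Nonempty)
    {u v : V} (p : G.Walk u v) (h : G.gate S u ≠ G.gate S v) :
    ∃ x y, s(x, y) ∈ p.edges ∧ x ∈ S ∧ y ∈ S := by
  induction p with
  | nil => exact absurd rfl h
  | @cons u w v hadj p ih =>
    by_cases hm : u ∈ S ∧ w ∈ S
    · exact ⟨u, w, by simp, hm.1, hm.2⟩
    · rw [gate_eq_of_adj hG hS hne hadj hm] at h
      obtain ⟨x, y, he, hxy⟩ := ih h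
      exact ⟨x, y, by simp [he], hxy⟩

/-- Up to its first edge inside `S` the path keeps its gate, which is the vertex where that edge
starts. If the end had the same gate, the rest of the path would return to this vertex. -/
theorem Walk.IsPath.gate_ne (hG : G.Connected) (hS : G.PathConvex S) {u v x y : V}
    {p : G.Walk u v} (hp : p.IsPath) (he : s(x, y) ∈ p.edges) (hx : x ∈ S) (hy : y ∈ S) :
    G.gate S u ≠ G.gate S v := by
  induction p with
  | nil => simp at he
  | @cons u w v hadj p ih =>
    rw [Walk.cons_isPath_iff] at hp
    by_cases hm : u ∈ S ∧ w ∈ S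
    · rw [gate_of_mem hG hS hm.1]
      intro h
      refine hp.2 ?_
      have := gate_mem_support hG hS hm.2 p.reverse
      rw [← h] at this
      simpa using this
    · rw [gate_eq_of_adj hG hS ⟨x, hx⟩ hadj hm]
      refine ih hp.1 ?_
      rw [Walk.edges_cons, List.mem_cons] at he
      refine he.resolve_left fun h => hm ?_
      rcases Sym2.eq_iff.1 h with ⟨rfl, rfl⟩ | ⟨rfl, rfl⟩
      exacts [⟨hx, hy⟩, ⟨hy, hx⟩]

theorem not_connAvoiding_gate (hG : G.Connected) (hS : G.PathConvex S) (hne : S.Nonempty)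
    {u v : V} (h : G.gate S u ≠ G.gate S v) : ¬ G.ConnAvoiding (G.gate S u) u v := by
  rintro ⟨p, hp⟩
  obtain ⟨q, -, hq⟩ := exists_walk_gate hG S v
  have := gate_mem_support hG hS (gate_mem hne v) (p.append q)
  rw [Walk.mem_support_append_iff] at this
  rcases this with h' | h'
  · exact hp h'
  · exact h (hq _ h' (gate_mem hne u))

theorem dist_eq_add_of_not_connAvoiding (hG : G.Connected) {a u v : V}
    (h : ¬ G.ConnAvoiding a u v) : G.dist u v = G.dist u a + G.dist a v := by
  classical
  obtain ⟨p, hp⟩ := hG.exists_walk_length_eq_dist u v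
  have ha : a ∈ p.support := by
    by_contra hc
    exact h ⟨p, hc⟩
  have h1 := congrArg Walk.length (p.take_spec ha)
  rw [Walk.length_append] at h1
  have h2 := G.dist_le (p.takeUntil a ha)
  have h3 := G.dist_le (p.dropUntil a ha)
  have h4 := hG.dist_triangle (u := u) (v := a) (w := v)
  omega

theorem dist_eq_add_gate (hG : G.Connected) (hS : G.PathConvex S) {v s : V} (hs : s ∈ S) :
    G.dist v s = G.dist v (G.gate S v) + G.dist (G.gate S v) s :=
  dist_eq_add_of_not_connAvoiding hG fun ⟨p, hp⟩ => hp (gate_mem_support hG hS hs p)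

theorem dist_eq_of_gate_ne (hG : G.Connected) (hS : G.PathConvex S) (hne : S.Nonempty)
    {u v : V} (h : G.gate S u ≠ G.gate S v) :
    G.dist u v = G.dist (G.gate S u) u + G.dist (G.gate S u) (G.gate S v) +
      G.dist (G.gate S v) v := by
  have h1 := dist_eq_add_of_not_connAvoiding hG (not_connAvoiding_gate hG hS hne h)
  have h2 := dist_eq_add_gate hG hS (v := v) (G.gate_mem hne u)
  have h3 := G.dist_comm (u := G.gate S u) (v := v)
  have h4 := G.dist_comm (u := G.gate S u) (v := u)
  have h5 := G.dist_comm (u := G.gate S v) (v := v)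
  have h6 := G.dist_comm (u := G.gate S u) (v := G.gate S v)
  omega

theorem connAvoiding_gate (hG : G.Connected) {a v : V} (ha : a ∈ S) (h : G.gate S v ≠ a) :
    G.ConnAvoiding a v (G.gate S v) := by
  obtain ⟨p, -, hp⟩ := exists_walk_gate hG S v
  exact ⟨p, fun hc => h (hp a hc ha).symm⟩

/-! ### How blocks meet; articulation points as common vertices of blocks. -/

section Blocks

variable [Finite V]

theorem Adj.exists_isBlock (hG : G.Connected) {u v : V} (h : G.Adj u v) :
    ∃ B, G.IsBlock B ∧ B.Adj u v := by
  obtain ⟨B, hB, hu, hv⟩ := exists_isBlock_of_linked hG h.linked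
  exact ⟨B, hB, (hB.adj_iff hG).2 ⟨hu, hv, h⟩⟩

theorem exists_isBlock_mem (hG : G.Connected) (v : V) : ∃ B, G.IsBlock B ∧ v ∈ B.verts := by
  obtain ⟨B, hB, hv, -⟩ := exists_isBlock_of_linked hG (Linked.refl v)
  exact ⟨B, hB, hv⟩

theorem IsBlock.exists_adj (hG : G.Connected) {B : G.Subgraph} (hB : G.IsBlock B) {u v : V}
    (hu : u ∈ B.verts) (hv : v ∈ B.verts) (hne : u ≠ v) : ∃ w, B.Adj u w := by
  obtain ⟨p, hp⟩ := hG.exists_isPath u v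
  cases p with
  | nil => exact absurd rfl hne
  | @cons _ w _ h p =>
    have hw := hB.pathConvex hG u hu v hv _ hp w (by simp)
    exact ⟨w, (hB.adj_iff hG).2 ⟨hu, hw, h⟩⟩

/-- Otherwise a path from `u` to `v`, which stays in `D`, would use an edge of `B`, giving two
common vertices of distinct blocks. -/
theorem IsBlock.gate_eq_gate (hG : G.Connected) {B D : G.Subgraph} (hB : G.IsBlock B)
    (hD : G.IsBlock D) (hne : B ≠ D) {u v : V} (hu : u ∈ D.verts) (hv : v ∈ D.verts) :
    G.gate B.verts u = G.gate B.verts v := by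
  by_contra h
  obtain ⟨p, hp⟩ := hG.exists_isPath u v
  obtain ⟨x, y, he, hx, hy⟩ :=
    exists_mem_edges_of_gate_ne hG (hB.pathConvex hG) hB.nonempty p h
  have hD' := hD.pathConvex hG u hu v hv p hp
  exact hne (hB.eq_of_mem_of_mem hG hD (p.adj_of_mem_edges he).ne hx hy
    (hD' _ (Walk.fst_mem_support_of_mem_edges _ he))
    (hD' _ (Walk.snd_mem_support_of_mem_edges _ he)))

/-- If two blocks meet in `c`, then every vertex sees one of them through `c`. -/
theorem IsBlock.gate_eq_or_gate_eq (hG : G.Connected) {B D : G.Subgraph} (hB : G.IsBlock B)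
    (hD : G.IsBlock D) (hne : B ≠ D) {c : V} (hcB : c ∈ B.verts) (hcD : c ∈ D.verts) (v : V) :
    G.gate B.verts v = c ∨ G.gate D.verts v = c := by
  by_contra! h
  obtain ⟨p, -, hp⟩ := exists_walk_gate hG B.verts v
  have h1 : G.gate D.verts (G.gate B.verts v) = c := by
    rw [hD.gate_eq_gate hG hB hne.symm (gate_mem hB.nonempty v) hcB]
    exact gate_of_mem hG (hD.pathConvex hG) hcD
  have h2 : G.gate D.verts (G.gate B.verts v) ≠ G.gate D.verts v := by
    rw [h1]
    exact h.2.symm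
  refine not_connAvoiding_gate hG (hD.pathConvex hG) hD.nonempty h2 ⟨p.reverse, ?_⟩
  rw [h1, Walk.support_reverse, List.mem_reverse]
  exact fun hc => h.1 (hp c hc hcB).symm

theorem exists_isBlock_gate_ne (hG : G.Connected) {a v : V} (hne : v ≠ a) :
    ∃ B, G.IsBlock B ∧ a ∈ B.verts ∧ G.gate B.verts v ≠ a := by
  obtain ⟨p, hp⟩ := hG.exists_isPath a v
  cases p with
  | nil => exact absurd rfl hne
  | @cons _ w _ h p =>
    obtain ⟨B, hB, hadj⟩ := h.exists_isBlock hG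
    -- `B` is the block of the first edge of the path. Were `a` the gate of `v`, the remainder of
    -- the path, read from `v` to `w ∈ B`, would have to visit `a` again.
    refine ⟨B, hB, B.edge_vert hadj, fun hg => ?_⟩
    rw [Walk.cons_isPath_iff] at hp
    have := gate_mem_support hG (hB.pathConvex hG) (B.edge_vert hadj.symm) p.reverse
    rw [hg] at this
    exact hp.2 (by simpa using this)

theorem IsBlock.connAvoiding_of_gate_ne (hG : G.Connected) {B : G.Subgraph} (hB : G.IsBlock B)
    {a u v : V} (ha : a ∈ B.verts) (hu : G.gate B.verts u ≠ a) (hv : G.gate B.verts v ≠ a) :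
    G.ConnAvoiding a u v :=
  ((connAvoiding_gate hG ha hu).trans (hB.linked hG (gate_mem ⟨a, ha⟩ u) (gate_mem ⟨a, ha⟩ v)
    a hu.symm hv.symm)).trans (connAvoiding_gate hG ha hv).symm

theorem isArticulationPoint_iff_exists_isBlock (hG : G.Connected) {a : V} :
    G.IsArticulationPoint a ↔
      ∃ B D, G.IsBlock B ∧ G.IsBlock D ∧ B ≠ D ∧ a ∈ B.verts ∧ a ∈ D.verts := by
  rw [isArticulationPoint_iff hG]
  constructor
  · rintro ⟨u, v, hu, hv, h⟩
    obtain ⟨B, hB, haB, hgB⟩ := exists_isBlock_gate_ne hG hu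
    obtain ⟨D, hD, haD, hgD⟩ := exists_isBlock_gate_ne hG hv
    refine ⟨B, D, hB, hD, ?_, haB, haD⟩
    rintro rfl
    exact h (hB.connAvoiding_of_gate_ne hG haB hgB hgD)
  · rintro ⟨B, D, hB, hD, hne, haB, haD⟩
    obtain ⟨u, hu, hua⟩ := hB.exists_ne hG hD hne haD
    obtain ⟨v, hv, hva⟩ := hD.exists_ne hG hB hne.symm haB
    refine ⟨u, v, hua, hva, ?_⟩
    have hg : G.gate B.verts v = a := by
      rw [hB.gate_eq_gate hG hD hne hv haD, gate_of_mem hG (hB.pathConvex hG) haB]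
    rintro ⟨p, hp⟩
    have := gate_mem_support hG (hB.pathConvex hG) hu p.reverse
    rw [hg] at this
    exact hp (by simpa using this)

end Blocks

end SimpleGraph

/-! ### The BC-tree is a tree. -/

namespace SimpleGraph

variable {V : Type*} {G : SimpleGraph V}

theorem Reachable.iff_of_forall_adj {φ : V → Prop} (h : ∀ u v, G.Adj u v → (φ u ↔ φ v)) {u v : V}
    (huv : G.Reachable u v) : φ u ↔ φ v := by
  obtain ⟨p⟩ := huv
  induction p with
  | nil => rfl
  | cons hadj _ ih => exact (h _ _ hadj).trans ih

section BCTree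

variable [Finite V]

theorem bcTree_reachable_of_mem (hG : G.Connected) {u : V} {B D : {B : G.Subgraph // G.IsBlock B}}
    (hB : u ∈ B.1.verts) (hD : u ∈ D.1.verts) : G.bcTree.Reachable (.inr B) (.inr D) := by
  by_cases hne : B = D
  · subst hne
    rfl
  · have ha : G.IsArticulationPoint u := (isArticulationPoint_iff_exists_isBlock hG).2
      ⟨B, D, B.2, D.2, fun h => hne (Subtype.ext h), hB, hD⟩
    have h1 : G.bcTree.Adj (.inr B) (.inl ⟨u, ha⟩) := hB
    have h2 : G.bcTree.Adj (.inl ⟨u, ha⟩) (.inr D) := hD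
    exact h1.reachable.trans h2.reachable

theorem bcTree_reachable_of_walk (hG : G.Connected) {u v : V} (p : G.Walk u v)
    {B D : {B : G.Subgraph // G.IsBlock B}} (hB : u ∈ B.1.verts) (hD : v ∈ D.1.verts) :
    G.bcTree.Reachable (.inr B) (.inr D) := by
  induction p generalizing B with
  | nil => exact bcTree_reachable_of_mem hG hB hD
  | cons h p ih =>
    obtain ⟨C, hC, hadj⟩ := h.exists_isBlock hG
    exact (bcTree_reachable_of_mem hG hB (D := ⟨C, hC⟩) (C.edge_vert hadj)).trans
      (ih (B := ⟨C, hC⟩) (C.edge_vert hadj.symm) hD)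

theorem bcTree_connected (hG : G.Connected) : G.bcTree.Connected := by
  obtain ⟨v⟩ := hG.nonempty
  obtain ⟨B, hB, hv⟩ := exists_isBlock_mem hG v
  have key : ∀ x : G.BCVertex, G.bcTree.Reachable (.inr ⟨B, hB⟩) x := by
    have hblock : ∀ D, G.bcTree.Reachable (.inr ⟨B, hB⟩) (.inr D) := by
      intro D
      obtain ⟨w, hw⟩ := D.2.nonempty
      obtain ⟨p⟩ := hG.preconnected v w
      exact bcTree_reachable_of_walk hG p hv hw
    rintro (a | D)
    · obtain ⟨D, hD, haD⟩ := exists_isBlock_mem hG a.1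
      have h : G.bcTree.Adj (.inr ⟨D, hD⟩) (.inl a) := haD
      exact (hblock ⟨D, hD⟩).trans h.reachable
    · exact hblock D
  exact connected_iff_exists_forall_reachable _ |>.2 ⟨_, key⟩

theorem bcTree_isBridge (hG : G.Connected) (c : {a : V // G.IsArticulationPoint a})
    (D : {B : G.Subgraph // G.IsBlock B}) (hc : c.1 ∈ D.1.verts) :
    G.bcTree.IsBridge s(.inl c, .inr D) := by
  rw [isBridge_iff]
  intro h
  -- `φ` marks the side of the edge that contains `D`: the vertices of the BC-tree containing a
  -- point that `D` sees through a gate other than `c`. No other edge changes `φ`, while `φ` holds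
  -- at `D` and fails at `c`.
  let φ : G.BCVertex → Prop := Sum.elim (fun a => G.gate D.1.verts a.1 ≠ c.1)
    (fun B => ∃ y ∈ B.1.verts, G.gate D.1.verts y ≠ c.1)
  have hstep : ∀ (a : {a : V // G.IsArticulationPoint a}) (B : {B : G.Subgraph // G.IsBlock B}),
      a.1 ∈ B.1.verts → ¬ (a = c ∧ B = D) → (φ (.inl a) ↔ φ (.inr B)) := by
    intro a B haB hne
    refine ⟨fun h => ⟨a, haB, h⟩, ?_⟩
    rintro ⟨y, hy, hyc⟩
    by_cases hBD : B = D
    · subst hBD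
      change G.gate B.1.verts a.1 ≠ c.1
      rw [gate_of_mem hG (B.2.pathConvex hG) haB]
      exact fun h => hne ⟨Subtype.ext h, rfl⟩
    · change G.gate D.1.verts a.1 ≠ c.1
      rwa [D.2.gate_eq_gate hG B.2 (fun h => hBD (Subtype.ext h.symm)) haB hy]
  have hφ := Reachable.iff_of_forall_adj (φ := φ) (fun u v huv => by
    rw [deleteEdges_adj] at huv
    obtain ⟨hadj, hne⟩ := huv
    rcases u with a | B <;> rcases v with a' | B'
    · exact hadj.elim
    · exact hstep a B' hadj (by rintro ⟨rfl, rfl⟩; simp at hne)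
    · exact (hstep a' B hadj (by rintro ⟨rfl, rfl⟩; simp [Sym2.eq_swap] at hne)).symm
    · exact hadj.elim) h
  obtain ⟨B₁, B₂, hB₁, hB₂, hne, h₁, h₂⟩ := (isArticulationPoint_iff_exists_isBlock hG).1 c.2
  have hD : φ (.inr D) := by
    obtain ⟨B, hB, hBD, hcB⟩ : ∃ B, G.IsBlock B ∧ D.1 ≠ B ∧ c.1 ∈ B.verts := by
      by_cases h : D.1 = B₁
      · exact ⟨B₂, hB₂, h ▸ hne, h₂⟩
      · exact ⟨B₁, hB₁, h, h₁⟩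
    obtain ⟨y, hy, hyc⟩ := D.2.exists_ne hG hB hBD hcB
    exact ⟨y, hy, by rwa [gate_of_mem hG (D.2.pathConvex hG) hy]⟩
  exact hφ.2 hD (gate_of_mem hG (D.2.pathConvex hG) hc)

theorem bcTree_isTree (hG : G.Connected) : G.bcTree.IsTree := by
  refine ⟨bcTree_connected hG, isAcyclic_iff_forall_adj_isBridge.2 ?_⟩
  rintro (a | B) (a' | B') h
  · exact h.elim
  · exact bcTree_isBridge hG _ _ h
  · rw [Sym2.eq_swap]
    exact bcTree_isBridge hG _ _ h
  · exact h.elim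

end BCTree

/-! ### Finite trees with at most one branching vertex. -/

theorem two_lt_encard_iff [Finite V] {s : Set V} :
    2 < s.encard ↔ ∃ a b c, a ∈ s ∧ b ∈ s ∧ c ∈ s ∧ a ≠ b ∧ a ≠ c ∧ b ≠ c := by
  rw [← s.toFinite.cast_ncard_eq, ← Set.two_lt_ncard_iff s.toFinite]
  norm_cast

/-- The edge between the two positions is a bridge, but for `i + 1 < j` the segment of the path
between them is a detour around it. -/
theorem IsAcyclic.getVert_adj (hG : G.IsAcyclic) {u v : V} {p : G.Walk u v} (hp : p.IsPath)
    {i j : ℕ} (hij : i < j) (hj : j ≤ p.length) (h : G.Adj (p.getVert i) (p.getVert j)) :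
    i + 1 = j := by
  by_contra hne
  have hb := isAcyclic_iff_forall_adj_isBridge.1 hG h
  rw [isBridge_iff] at hb
  have key : ∀ m, i + m ≤ j → (G.deleteEdges {s(p.getVert i, p.getVert j)}).Reachable
      (p.getVert i) (p.getVert (i + m)) := by
    intro m
    induction m with
    | zero => intro _; rfl
    | succ m ih =>
      intro hm
      refine (ih (by omega)).trans (Adj.reachable ?_)
      rw [deleteEdges_adj]
      refine ⟨p.adj_getVert_succ (by omega), fun he => ?_⟩
      rw [Set.mem_singleton_iff, Sym2.eq_iff] at he
      have hinj : ∀ k l, k ≤ p.length → l ≤ p.length → p.getVert k = p.getVert l → k = l :=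
        fun k l hk hl h => hp.getVert_injOn hk hl h
      rcases he with ⟨h1, h2⟩ | ⟨h1, h2⟩
      · have h1 := hinj _ _ (by omega) (by omega) h1
        have h2 := hinj _ _ (by omega) (by omega) h2
        omega
      · have h1 := hinj _ _ (by omega) (by omega) h1
        omega
  have := key (j - i) (by omega)
  rw [show i + (j - i) = j by omega] at this
  exact hb this

/-- A finite tree in which all degrees are at most 2 is a path. -/
theorem IsTree.isPathShaped [Finite V] (hG : G.IsTree)
    (hdeg : ∀ v, ¬ 2 < (G.neighborSet v).encard) : G.IsPathShaped := by
  have := hG.1.nonempty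
  obtain ⟨u, v, p, hp, hmax⟩ := Walk.exists_isPath_forall_isPath_length_le_length G
  have hinj : ∀ k l, k ≤ p.length → l ≤ p.length → p.getVert k = p.getVert l → k = l :=
    fun k l hk hl h => hp.getVert_injOn hk hl h
  have hsurj : ∀ w, ∃ i ≤ p.length, p.getVert i = w := by
    -- A neighbour off the longest path `p` would prolong it at an end, or be a third neighbour of
    -- an inner vertex. So `p` is closed under adjacency and covers the tree.
    have hstep : ∀ i ≤ p.length, ∀ w, G.Adj (p.getVert i) w →
        ∃ j ≤ p.length, p.getVert j = w := by
      intro i hi w hw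
      by_contra! hc
      have hws : w ∉ p.support := by
        rw [Walk.mem_support_iff_exists_getVert]
        rintro ⟨n, hn, hnl⟩
        exact hc n hnl hn
      rcases Nat.eq_zero_or_pos i with rfl | hi0
      · rw [Walk.getVert_zero] at hw
        have := hmax _ _ (.cons hw.symm p) ((Walk.cons_isPath_iff _ _).2 ⟨hp, hws⟩)
        simp at this
      rcases hi.eq_or_lt with rfl | hi'
      · rw [Walk.getVert_length] at hw
        have := hmax _ _ (.cons hw.symm p.reverse)
          ((Walk.cons_isPath_iff _ _).2 ⟨hp.reverse, by simpa using hws⟩)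
        simp at this
      refine hdeg (p.getVert i) (two_lt_encard_iff.2
        ⟨p.getVert (i - 1), p.getVert (i + 1), w, ?_, ?_, hw, ?_, hc _ (by omega), hc _ (by omega)⟩)
      · have := p.adj_getVert_succ (i := i - 1) (by omega)
        rw [show i - 1 + 1 = i by omega] at this
        exact this.symm
      · exact p.adj_getVert_succ hi'
      · intro h
        have := hinj _ _ (by omega) (by omega) h
        omega
    intro w
    have := (Reachable.iff_of_forall_adj (G := G) (φ := fun w => ∃ i ≤ p.length, p.getVert i = w)
      (u := u) (v := w) ?_ (hG.1.preconnected u w)).1 ⟨0, by omega, by simp⟩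
    · exact this
    · intro x y hxy
      constructor
      · rintro ⟨i, hi, rfl⟩
        exact hstep i hi y hxy
      · rintro ⟨i, hi, rfl⟩
        exact hstep i hi x hxy.symm
  let f : Fin (p.length + 1) → V := fun i => p.getVert i
  have hf : Function.Bijective f := by
    constructor
    · intro i j hij
      exact Fin.ext (hinj _ _ (by omega) (by omega) hij)
    · intro w
      obtain ⟨i, hi, rfl⟩ := hsurj w
      exact ⟨⟨i, by omega⟩, rfl⟩
  refine ⟨p.length, ⟨RelIso.symm ⟨Equiv.ofBijective f hf, ?_⟩⟩⟩
  intro i j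
  rw [pathGraph_adj]
  change G.Adj (p.getVert i) (p.getVert j) ↔ _
  constructor
  · intro h
    rcases lt_trichotomy i.1 j.1 with hij | hij | hij
    · exact .inl (hG.2.getVert_adj hp hij (by omega) h)
    · rw [hij] at h
      exact (h.ne rfl).elim
    · exact .inr (hG.2.getVert_adj hp hij (by omega) h.symm)
  · rintro (h | h)
    · rw [← h]
      exact p.adj_getVert_succ (by omega)
    · rw [← h]
      exact (p.adj_getVert_succ (by omega)).symm

/-- A finite tree with at most one vertex of degree greater than 2 is a path or starlike. -/
theorem IsTree.isPathShaped_or_isStarlike [Finite V] (hG : G.IsTree)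
    (h : ∀ u v, 2 < (G.neighborSet u).encard → 2 < (G.neighborSet v).encard → u = v) :
    G.IsPathShaped ∨ G.IsStarlike := by
  by_cases hc : ∃ v, 2 < (G.neighborSet v).encard
  · obtain ⟨v, hv⟩ := hc
    exact .inr ⟨hG, v, hv, fun u hu => h u v hu hv⟩
  · push Not at hc
    exact .inl (hG.isPathShaped fun v => (hc v).not_gt)

end SimpleGraph

/-! ### Connected unions of blocks: isometry and inherited block structure. -/

namespace SimpleGraph

variable {V : Type*} {G : SimpleGraph V}

theorem Iso.linked {W : Type*} {H : SimpleGraph W} (φ : G ≃g H) {u v : V} (h : G.Linked u v) :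
    H.Linked (φ u) (φ v) := by
  intro x hxu hxv
  obtain ⟨p, hp⟩ := h (φ.symm x) (fun h => hxu (by simp [← h])) (fun h => hxv (by simp [← h]))
  refine ⟨p.map φ.toHom, fun hx => hp ?_⟩
  obtain ⟨y, hy, hyx⟩ := List.mem_map.1
      (Eq.mp (congrArg (x ∈ ·) (Walk.support_map φ.toHom p)) hx)
  have : φ.symm x = y := by
    rw [← hyx]
    exact φ.symm_apply_apply y
  rwa [this]

theorem Iso.isNonseparable [Finite V] {W : Type*} [Finite W] {H : SimpleGraph W} (φ : G ≃g H)
    (h : G.IsNonseparable) : H.IsNonseparable := by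
  rw [isNonseparable_iff] at h ⊢
  refine ⟨φ.connected_iff.1 h.1, fun u v => ?_⟩
  have := φ.linked (h.2 (φ.symm u) (φ.symm v))
  simpa using this

namespace Subgraph

/-- A subgraph of a subgraph is isomorphic to the corresponding subgraph of the graph. -/
noncomputable def coeSubgraphIso {H : G.Subgraph} (D : H.coe.Subgraph) :
    D.coe ≃g (Subgraph.coeSubgraph D).coe where
  toEquiv := Equiv.Set.image Subtype.val D.verts Subtype.val_injective
  map_rel_iff' := by
    intro x y
    change (Subgraph.coeSubgraph D).Adj _ _ ↔ D.Adj _ _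
    rw [coeSubgraph_adj]
    exact ⟨fun ⟨_, _, h⟩ => h, fun h => ⟨x.1.2, y.1.2, h⟩⟩

theorem isNonseparable_coeSubgraph_iff [Finite V] {H : G.Subgraph} {D : H.coe.Subgraph} :
    (Subgraph.coeSubgraph D).coe.IsNonseparable ↔ D.coe.IsNonseparable :=
  ⟨fun h => (coeSubgraphIso D).symm.isNonseparable h, fun h => (coeSubgraphIso D).isNonseparable h⟩

theorem not_connAvoiding_coe {H : G.Subgraph} {a u v : H.verts} (h : ¬ G.ConnAvoiding a.1 u.1 v.1) :
    ¬ H.coe.ConnAvoiding a u v := by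
  rintro ⟨p, hp⟩
  exact h ⟨p.map H.hom, fun hc => hp ((mem_support_map_hom p).1 hc)⟩

theorem coeSubgraph_restrict_of_le {H D : G.Subgraph} (h : D ≤ H) :
    Subgraph.coeSubgraph (H.restrict D) = D := by
  rw [coeSubgraph_restrict_eq, inf_eq_right.2 h]

/-- A connected subgraph that is the union of the blocks of `G` that it contains. -/
structure IsBlockUnion (H : G.Subgraph) : Prop where
  connected : H.Connected
  exists_mem : ∀ v ∈ H.verts, ∃ D, G.IsBlock D ∧ D ≤ H ∧ v ∈ D.verts
  exists_adj : ∀ u v, H.Adj u v → ∃ D, G.IsBlock D ∧ D ≤ H ∧ D.Adj u v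

variable [Finite V] {H : G.Subgraph}

/-- An edge of `p` lies in a block `D` in which `u` and `v` have different gates. A walk from `u` to
`v` inside `H` must then also use an edge of `D`; as `H` is a union of blocks, it contains all of
`D`. -/
theorem IsBlockUnion.toSubgraph_le (hG : G.Connected) (hH : H.IsBlockUnion) {u v : V}
    (hu : u ∈ H.verts) (hv : v ∈ H.verts) {p : G.Walk u v} (hp : p.IsPath) :
    p.toSubgraph ≤ H := by
  have key : ∀ x y, s(x, y) ∈ p.edges → H.Adj x y := by
    intro x y he
    obtain ⟨D, hD, hxy⟩ := (p.adj_of_mem_edges he).exists_isBlock hG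
    have hgate := hp.gate_ne hG (hD.pathConvex hG) he (D.edge_vert hxy) (D.edge_vert hxy.symm)
    obtain ⟨q, hq⟩ := (H.connected_iff_forall_exists_walk_subgraph.1 hH.connected).2 hu hv
    obtain ⟨x', y', he', hx', hy'⟩ :=
      exists_mem_edges_of_gate_ne hG (hD.pathConvex hG) hD.nonempty q hgate
    obtain ⟨D', hD', hle, hadj⟩ := hH.exists_adj x' y' (hq.2 (Walk.adj_toSubgraph_iff_mem_edges.2 he'))
    have : D' = D := hD'.eq_of_adj hG hD hadj ((hD.adj_iff hG).2 ⟨hx', hy', hadj.adj_sub⟩)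
    exact hle.2 (this ▸ hxy)
  by_cases hnil : p.Nil
  · cases hnil
    simpa using hu
  · rw [Walk.toSubgraph_le_iff hnil]
    intro e
    induction e using Sym2.ind with | _ x y
    exact key x y

theorem IsBlockUnion.edist_coe (hG : G.Connected) (hH : H.IsBlockUnion) (u v : H.verts) :
    H.coe.edist u v = G.edist u v := by
  apply le_antisymm
  · obtain ⟨p, hp, hl⟩ := hG.exists_path_of_dist u.1 v.1
    have hl' : (p.length : ℕ∞) = G.edist u v := by
      rw [hl, (hG.preconnected u.1 v.1).coe_dist_eq_edist]
    obtain ⟨q, hq⟩ := exists_coe_walk p (hH.toSubgraph_le hG u.2 v.2 hp)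
    have := H.coe.edist_le q
    rw [← Walk.length_map H.hom q, hq] at this
    exact this.trans_eq hl'
  · obtain ⟨q, hq⟩ := (hH.connected.coe).exists_walk_length_eq_edist u v
    rw [← hq, ← Walk.length_map H.hom q]
    exact G.edist_le (q.map H.hom)

theorem IsBlockUnion.dist_coe (hG : G.Connected) (hH : H.IsBlockUnion) (u v : H.verts) :
    H.coe.dist u v = G.dist u v := by
  rw [dist, dist, hH.edist_coe hG]

theorem IsBlockUnion.distTo_coe (hG : G.Connected) (hH : H.IsBlockUnion) (D : H.coe.Subgraph)
    (v : H.verts) : H.coe.distTo D v = G.distTo (Subgraph.coeSubgraph D) v := by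
  rw [distTo, distTo, verts_coeSubgraph, iInf_image]
  simp only [hH.edist_coe hG]

theorem isBlock_restrict {D : G.Subgraph} (hD : G.IsBlock D) (h : D ≤ H) :
    H.coe.IsBlock (H.restrict D) := by
  constructor
  · refine isNonseparable_coeSubgraph_iff.1 ?_
    rw [coeSubgraph_restrict_of_le h]
    exact hD.prop
  · intro C hC hle
    have h1 := hD.eq_of_le (isNonseparable_coeSubgraph_iff.2 hC) (by
      rw [← coeSubgraph_restrict_of_le h]
      exact Subgraph.map_mono hle)
    rw [h1, restrict_coeSubgraph]

theorem IsBlockUnion.isBlock_coeSubgraph (hG : G.Connected) (hH : H.IsBlockUnion)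
    {C : H.coe.Subgraph} (hC : H.coe.IsBlock C) : G.IsBlock (Subgraph.coeSubgraph C) := by
  have hns := isNonseparable_coeSubgraph_iff.2 hC.prop
  obtain ⟨D, hD, hDH, hCD⟩ : ∃ D, G.IsBlock D ∧ D ≤ H ∧ Subgraph.coeSubgraph C ≤ D := by
    obtain ⟨u, hu⟩ := hC.nonempty
    have huC : u.1 ∈ (Subgraph.coeSubgraph C).verts := ⟨u, hu, rfl⟩
    -- A one-vertex `C` has no edge to identify the block of `G` inside `H`, so a block at its
    -- vertex is taken instead. Otherwise any block of `G` containing `C` shares an edge with `H`,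
    -- hence lies in `H`.
    by_cases hsub : ∀ v ∈ (Subgraph.coeSubgraph C).verts, v = u.1
    · obtain ⟨D, hD, hDH, huD⟩ := hH.exists_mem u.1 u.2
      refine ⟨D, hD, hDH, fun v hv => hsub v hv ▸ huD, fun v w hvw => ?_⟩
      refine absurd ?_ hvw.ne
      rw [hsub v (edge_vert _ hvw), hsub w (edge_vert _ hvw.symm)]
    · push Not at hsub
      obtain ⟨v, hv, hvu⟩ := hsub
      obtain ⟨D, hCD, hD⟩ := Set.Finite.exists_le_maximal
        (Set.toFinite {D : G.Subgraph | D.coe.IsNonseparable}) hns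
      have hD : G.IsBlock D := hD
      refine ⟨D, hD, ?_, hCD⟩
      obtain ⟨p, hp⟩ := hG.exists_isPath u.1 v
      have hle := hH.toSubgraph_le hG u.2 (coeSubgraph_le C |>.1 hv) hp
      have hDp := hD.pathConvex hG u.1 (hCD.1 huC) v (hCD.1 hv) p hp
      cases p with
      | nil => exact absurd rfl hvu
      | @cons _ w _ h p =>
        have hadj : H.Adj u.1 w := hle.2 (by simp)
        obtain ⟨D', hD', hle', hadj'⟩ := hH.exists_adj _ _ hadj
        have : D' = D := hD'.eq_of_adj hG hD hadj'
          ((hD.adj_iff hG).2 ⟨hCD.1 huC, hDp w (by simp), h⟩)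
        exact this ▸ hle'
  have h1 : C ≤ H.restrict D := by
    rw [← restrict_coeSubgraph C]
    exact Subgraph.comap_monotone H.hom hCD
  have h2 : C = H.restrict D := hC.eq_of_le (isBlock_restrict hD hDH).prop h1
  rw [h2, coeSubgraph_restrict_of_le hDH]
  exact hD

theorem IsBlockUnion.isArticulationPoint (hG : G.Connected) (hH : H.IsBlockUnion) {a : H.verts}
    (ha : H.coe.IsArticulationPoint a) : G.IsArticulationPoint a.1 := by
  rw [isArticulationPoint_iff_exists_isBlock hH.connected.coe] at ha
  rw [isArticulationPoint_iff_exists_isBlock hG]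
  obtain ⟨B, D, hB, hD, hne, haB, haD⟩ := ha
  exact ⟨_, _, hH.isBlock_coeSubgraph hG hB, hH.isBlock_coeSubgraph hG hD,
    fun h => hne (coeSubgraph_injective H h), ⟨a, haB, rfl⟩, ⟨a, haD, rfl⟩⟩

/-- The vertex of the BC-tree of `G` given by a vertex of the BC-tree of a union of blocks. -/
def IsBlockUnion.bcVertexMap (hG : G.Connected) (hH : H.IsBlockUnion) :
    H.coe.BCVertex → G.BCVertex :=
  Sum.map (fun a => ⟨a.1.1, hH.isArticulationPoint hG a.2⟩)
    (fun B => ⟨Subgraph.coeSubgraph B.1, hH.isBlock_coeSubgraph hG B.2⟩)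

theorem IsBlockUnion.bcVertexMap_injective (hG : G.Connected) (hH : H.IsBlockUnion) :
    Function.Injective (hH.bcVertexMap hG) := by
  refine Sum.map_injective.2 ⟨fun a b h => ?_, fun B D h => ?_⟩
  · exact Subtype.ext (Subtype.ext (Subtype.mk.inj h))
  · exact Subtype.ext (coeSubgraph_injective H (Subtype.mk.inj h))

theorem IsBlockUnion.bcTreeIsSubgraph (hG : G.Connected) (hH : H.IsBlockUnion) :
    G.BCTreeIsSubgraph H := by
  refine ⟨⟨hH.bcVertexMap hG, ?_⟩, hH.bcVertexMap_injective hG,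
    fun a => ⟨hH.isArticulationPoint hG a.2, rfl⟩,
    fun B => ⟨hH.isBlock_coeSubgraph hG B.2, rfl⟩⟩
  rintro (a | B) (a' | B') h
  · exact h.elim
  · exact ⟨a.1, h, rfl⟩
  · exact ⟨a'.1, h, rfl⟩
  · exact h.elim

end Subgraph

end SimpleGraph

/-! ### Two criteria locating the centre and the central blocks. -/

namespace SimpleGraph

variable {V : Type*} {G : SimpleGraph V}

theorem Connected.coe_dist (hG : G.Connected) (u v : V) : (G.dist u v : ℕ∞) = G.edist u v :=
  (hG.preconnected u v).coe_dist_eq_edist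

theorem Connected.dist_le_eccent (hG : G.Connected) (u v : V) :
    (G.dist u v : ℕ∞) ≤ G.eccent u := by
  rw [hG.coe_dist]
  exact edist_le_eccent

theorem distTo_eq (hG : G.Connected) {B : G.Subgraph} (hB : B.verts.Nonempty) (v : V) :
    G.distTo B v = G.dist (G.gate B.verts v) v := by
  apply le_antisymm
  · rw [hG.coe_dist]
    exact iInf₂_le _ (gate_mem hB v)
  · refine le_iInf₂ fun u hu => ?_
    rw [← hG.coe_dist, Nat.cast_le, G.dist_comm (u := u), G.dist_comm (v := v)]
    exact dist_gate_le hu v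

theorem distTo_le_edist {B : G.Subgraph} {u : V} (hu : u ∈ B.verts) (v : V) :
    G.distTo B v ≤ G.edist u v :=
  iInf₂_le u hu

theorem distTo_le_blockEccent (B : G.Subgraph) (v : V) : G.distTo B v ≤ G.blockEccent B :=
  le_iSup (G.distTo B) v

theorem blockRadius_le {B : G.Subgraph} (hB : G.IsBlock B) : G.blockRadius ≤ G.blockEccent B :=
  iInf₂_le B hB

variable [Finite V]

theorem exists_dist_eq_eccent (hG : G.Connected) (u : V) :
    ∃ v, (G.dist u v : ℕ∞) = G.eccent u := by
  have := hG.nonempty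
  obtain ⟨v, hv⟩ := G.exists_edist_eq_eccent_of_finite u
  exact ⟨v, by rw [hG.coe_dist, hv]⟩

/-- If all vertices have distance at most `r` from `a`, and `a` separates two vertices at
distance `r` from `a`, then `a` is the centre of the graph. -/
theorem center_of_bipolar (hG : G.Connected) {a f₁ f₂ : V} {r : ℕ}
    (hr : ∀ v, G.dist a v ≤ r) (h₁ : G.dist a f₁ = r) (h₂ : G.dist a f₂ = r)
    (hs : ¬ G.ConnAvoiding a f₁ f₂) :
    G.center = {a} ∧ G.radius = r ∧ G.ediam = (2 * r : ℕ) ∧ G.blockRadius = r ∧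
      G.centralBlocks = {D | G.IsBlock D ∧ a ∈ D.verts} := by
  have := hG.nonempty
  have hecca : G.eccent a = r := by
    apply le_antisymm
    · rw [eccent_le_iff]
      intro v
      rw [← hG.coe_dist, Nat.cast_le]
      exact hr v
    · rw [← h₁]
      exact hG.dist_le_eccent a f₁
  -- Every `x` is separated by `a` from at least one of the two poles, and that pole is at distance
  -- `d(x, a) + r`.
  have hecc : ∀ x, ((G.dist x a + r : ℕ) : ℕ∞) ≤ G.eccent x := by
    intro x
    have hx : ¬ G.ConnAvoiding a x f₁ ∨ ¬ G.ConnAvoiding a x f₂ := by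
      by_contra! h
      exact hs (h.1.symm.trans h.2)
    rcases hx with hx | hx
    · rw [← h₁, ← dist_eq_add_of_not_connAvoiding hG hx]
      exact hG.dist_le_eccent x f₁
    · rw [← h₂, ← dist_eq_add_of_not_connAvoiding hG hx]
      exact hG.dist_le_eccent x f₂
  have hrad : G.radius = r := by
    apply le_antisymm
    · rw [← hecca]
      exact radius_le_eccent
    · obtain ⟨u, hu⟩ := G.exists_eccent_eq_radius
      rw [← hu]
      exact le_trans (by simp) (hecc u)
  have hble : ∀ D : G.Subgraph, a ∈ D.verts → G.blockEccent D ≤ r := by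
    intro D ha
    refine iSup_le fun v => (distTo_le_edist ha v).trans ?_
    rw [← hG.coe_dist, Nat.cast_le]
    exact hr v
  have hbge : ∀ D, G.IsBlock D → ∃ g ∈ D.verts,
      ((G.dist g a + r : ℕ) : ℕ∞) ≤ G.blockEccent D := by
    intro D hD
    -- One pole is separated by `a` from the whole block: otherwise two vertices of `D`, linked to
    -- each other, would connect the poles off `a`.
    have h : (∀ x ∈ D.verts, ¬ G.ConnAvoiding a x f₁) ∨
        (∀ x ∈ D.verts, ¬ G.ConnAvoiding a x f₂) := by
      by_contra! h
      obtain ⟨⟨x, hx, hx₁⟩, y, hy, hy₂⟩ := h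
      have hax : a ≠ x := by
        rintro rfl
        obtain ⟨p, hp⟩ := hx₁
        exact hp p.start_mem_support
      have hay : a ≠ y := by
        rintro rfl
        obtain ⟨p, hp⟩ := hy₂
        exact hp p.start_mem_support
      exact hs ((hx₁.symm.trans (hD.linked hG hx hy a hax hay)).trans hy₂)
    have key : ∀ f, G.dist a f = r → (∀ x ∈ D.verts, ¬ G.ConnAvoiding a x f) →
        ∃ g ∈ D.verts, ((G.dist g a + r : ℕ) : ℕ∞) ≤ G.blockEccent D := by
      intro f hf h
      refine ⟨G.gate D.verts f, gate_mem hD.nonempty f, ?_⟩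
      rw [← hf, ← dist_eq_add_of_not_connAvoiding hG (h _ (gate_mem hD.nonempty f)),
        ← distTo_eq hG hD.nonempty]
      exact distTo_le_blockEccent D f
    rcases h with h | h
    · exact key f₁ h₁ h
    · exact key f₂ h₂ h
  have hbrad : G.blockRadius = r := by
    apply le_antisymm
    · obtain ⟨B, hB, haB⟩ := exists_isBlock_mem hG a
      exact (blockRadius_le hB).trans (hble B haB)
    · refine le_iInf₂ fun D hD => ?_
      obtain ⟨g, -, hg⟩ := hbge D hD
      exact le_trans (by simp) hg
  refine ⟨?_, hrad, ?_, hbrad, ?_⟩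
  · ext x
    rw [mem_center_iff, hrad, Set.mem_singleton_iff]
    constructor
    · intro hx
      have := hecc x
      rw [hx, Nat.cast_le] at this
      exact hG.dist_eq_zero_iff.1 (by omega)
    · rintro rfl
      exact hecca
  · apply le_antisymm
    · refine ediam_le_of_edist_le fun u v => ?_
      rw [← hG.coe_dist, Nat.cast_le]
      have h1 := hG.dist_triangle (u := u) (v := a) (w := v)
      rw [G.dist_comm (u := u) (v := a)] at h1
      have h2 := hr u
      have h3 := hr v
      omega
    · have := dist_eq_add_of_not_connAvoiding hG hs
      rw [G.dist_comm (v := a), h₁, h₂] at this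
      rw [two_mul, ← this, hG.coe_dist]
      exact edist_le_ediam
  · ext D
    rw [centralBlocks, Set.mem_ofPred_eq, Set.mem_ofPred_eq, hbrad]
    refine and_congr_right fun hD => ⟨fun h => ?_, fun h => ?_⟩
    · obtain ⟨g, hg, hgD⟩ := hbge D hD
      rw [h, Nat.cast_le] at hgD
      have : g = a := hG.dist_eq_zero_iff.1 (by omega)
      exact this ▸ hg
    · refine (hble D h).antisymm ?_
      obtain ⟨g, -, hg⟩ := hbge D hD
      exact le_trans (by simp) hg

/-- If every vertex of the block `B` has eccentricity greater than `B` itself, then `B` is the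
unique central block and contains the centre. -/
theorem center_subset_of_isBlock (hG : G.Connected) {B : G.Subgraph} (hB : G.IsBlock B) {s : ℕ}
    (hs : G.blockEccent B = s) (hc : ∀ c ∈ B.verts, ∃ w, s < G.dist c w) :
    G.center ⊆ B.verts ∧ G.blockRadius = s ∧ G.centralBlocks = {B} := by
  have hle : ∀ v, G.dist (G.gate B.verts v) v ≤ s := by
    intro v
    have := distTo_le_blockEccent B v
    rwa [hs, distTo_eq hG hB.nonempty, Nat.cast_le] at this
  have hgate : ∀ c w, s < G.dist c w → c ≠ G.gate B.verts w := by
    rintro c w h rfl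
    have := hle w
    omega
  -- A vertex `w` farther than `s` from the gate of `x` has another gate, so the gate of `x`
  -- separates `x` from `w`. Moving out of `B` therefore only increases the distance to `w`.
  have hlt : ∀ x w, s < G.dist (G.gate B.verts x) w →
      G.dist x w = G.dist x (G.gate B.verts x) + G.dist (G.gate B.verts x) w := fun x w hw =>
    dist_eq_add_of_not_connAvoiding hG
      (not_connAvoiding_gate hG (hB.pathConvex hG) hB.nonempty (hgate _ w hw))
  have hD : ∀ D, G.IsBlock D → D ≠ B → (s : ℕ∞) < G.blockEccent D := by
    intro D hD hne
    obtain ⟨x, hx⟩ := hD.nonempty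
    obtain ⟨w, hw⟩ := hc (G.gate B.verts x) (gate_mem hB.nonempty x)
    refine lt_of_lt_of_le ?_ (distTo_le_blockEccent D w)
    rw [distTo_eq hG hD.nonempty, Nat.cast_lt]
    -- All of `D` has one gate in `B`, so the vertex of `D` nearest to `w` is at least as far from
    -- `w` as that gate.
    have h1 := G.gate_mem hD.nonempty w
    rw [hB.gate_eq_gate hG hD hne.symm hx h1] at hw
    have := hlt _ _ hw
    omega
  have hbrad : G.blockRadius = s := by
    apply le_antisymm
    · rw [← hs]
      exact blockRadius_le hB
    · refine le_iInf₂ fun D hD' => ?_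
      by_cases h : D = B
      · rw [h, hs]
      · exact (hD D hD' h).le
  refine ⟨fun x hx => ?_, hbrad, ?_⟩
  · by_contra hxB
    obtain ⟨w, hw⟩ := exists_dist_eq_eccent hG (G.gate B.verts x)
    obtain ⟨w', hw'⟩ := hc (G.gate B.verts x) (gate_mem hB.nonempty x)
    have h1 := hG.dist_le_eccent (G.gate B.verts x) w'
    rw [← hw, Nat.cast_le] at h1
    have h2 := hlt x w (by omega)
    have h3 : 0 < G.dist x (G.gate B.verts x) := hG.pos_dist_of_ne fun h =>
      hxB (by rw [h]; exact gate_mem hB.nonempty x)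
    have h4 := hG.dist_le_eccent x w
    rw [(G.mem_center_iff x).1 hx] at h4
    have h5 := h4.trans (radius_le_eccent (u := G.gate B.verts x))
    rw [← hw, Nat.cast_le] at h5
    omega
  · ext D
    rw [centralBlocks, Set.mem_ofPred_eq, Set.mem_singleton_iff, hbrad]
    constructor
    · rintro ⟨hD', h⟩
      by_contra hne
      exact (hD D hD' hne).ne h.symm
    · rintro rfl
      exact ⟨hB, hs⟩

end SimpleGraph

/-! ### Articulation components described inside `G` by the branch graph. -/

namespace SimpleGraph

variable {V : Type*} {G : SimpleGraph V}

/-- The subgraph of `G` represented by a vertex of the BC-tree. -/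
def rootSubgraph (G : SimpleGraph V) : G.BCVertex → G.Subgraph :=
  Sum.elim (fun a => G.singletonSubgraph a.1) (fun B => B.1)

/-- The vertices that a vertex of the BC-tree removes from its articulation components. -/
def excluded (G : SimpleGraph V) : G.BCVertex → Set V :=
  Sum.elim (fun a => {a.1}) (fun _ => ∅)

/-- The graph without the edges at an articulation point, or without the edges of a block. -/
def branchGraph (G : SimpleGraph V) : G.BCVertex → SimpleGraph V
  | .inl a =>
    { Adj := fun u v => G.Adj u v ∧ u ≠ a.1 ∧ v ≠ a.1
      symm := ⟨fun _ _ h => ⟨h.1.symm, h.2.2, h.2.1⟩⟩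
      loopless := ⟨fun _ h => h.1.ne rfl⟩ }
  | .inr B =>
    { Adj := fun u v => G.Adj u v ∧ ¬ (u ∈ B.1.verts ∧ v ∈ B.1.verts)
      symm := ⟨fun _ _ h => ⟨h.1.symm, fun h' => h.2 h'.symm⟩⟩
      loopless := ⟨fun _ h => h.1.ne rfl⟩ }

theorem excluded_subset (x : G.BCVertex) : G.excluded x ⊆ (G.rootSubgraph x).verts := by
  rcases x with a | B
  · exact subset_rfl
  · exact Set.empty_subset _

theorem branchGraph_le (x : G.BCVertex) : G.branchGraph x ≤ G := by
  rcases x with a | B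
  · exact fun _ _ h => h.1
  · exact fun _ _ h => h.1

theorem branchGraph_adj_of_notMem {x : G.BCVertex} {u v : V} (h : G.Adj u v)
    (hu : u ∉ (G.rootSubgraph x).verts) (hv : v ∉ (G.rootSubgraph x).verts) :
    (G.branchGraph x).Adj u v := by
  rcases x with a | B
  · exact ⟨h, hu, hv⟩
  · exact ⟨h, fun h => hu h.1⟩

theorem notMem_excluded_of_adj {x : G.BCVertex} {u v : V} (h : (G.branchGraph x).Adj u v) :
    v ∉ G.excluded x := by
  rcases x with a | B
  · exact h.2.2
  · exact fun h => h

theorem notMem_excluded_of_reachable {x : G.BCVertex} {u v : V}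
    (h : (G.branchGraph x).Reachable u v) (hu : u ∉ G.excluded x) : v ∉ G.excluded x := by
  obtain ⟨p⟩ := h
  induction p with
  | nil => exact hu
  | cons hadj _ ih => exact ih (notMem_excluded_of_adj hadj)

theorem branchGraph_reachable_of_walk {x : G.BCVertex} {u v : V} (p : G.Walk u v)
    (hp : ∀ w ∈ p.support, w ∉ (G.rootSubgraph x).verts) : (G.branchGraph x).Reachable u v := by
  induction p with
  | nil => rfl
  | cons hadj p ih =>
    exact (branchGraph_adj_of_notMem hadj (hp _ (by simp)) (hp _ (by simp))).reachable.trans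
      (ih fun w hw => hp w (by simp [hw]))

theorem connAvoiding_iff_branchGraph_reachable {a : {a : V // G.IsArticulationPoint a}} {u v : V}
    (hu : u ≠ a.1) : G.ConnAvoiding a.1 u v ↔ (G.branchGraph (.inl a)).Reachable u v := by
  constructor
  · rintro ⟨p, hp⟩
    exact branchGraph_reachable_of_walk p fun w hw h => hp ((show w = a.1 from h) ▸ hw)
  · rintro ⟨p⟩
    induction p with
    | nil => exact .refl hu.symm
    | cons hadj p ih =>
      refine ConnAvoiding.trans ⟨.cons hadj.1 .nil, ?_⟩ (ih hadj.2.2)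
      simp [hadj.2.1.symm, hadj.2.2.symm]

theorem exists_mem_notMem_excluded_of_bcTree_adj {x y z : G.BCVertex}
    (h : G.bcTree.Adj y z) (hy : y ≠ x) (hz : z ≠ x) :
    ∃ c ∈ (G.rootSubgraph y).verts, c ∈ (G.rootSubgraph z).verts ∧ c ∉ G.excluded x := by
  have key : ∀ a : {a : V // G.IsArticulationPoint a}, (.inl a : G.BCVertex) ≠ x →
      a.1 ∉ G.excluded x := by
    intro a ha
    rcases x with a' | B
    · exact fun h => ha (congrArg Sum.inl (Subtype.ext h))
    · exact fun h => h
  rcases y with a | B <;> rcases z with a' | B'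
  · exact h.elim
  · exact ⟨a.1, rfl, h, key a hy⟩
  · exact ⟨a'.1, h, rfl, key a' hz⟩
  · exact h.elim

theorem mem_shadow {S : Set G.BCVertex} {v : V} :
    v ∈ (G.shadow S).verts ↔ ∃ D, ∃ hD : G.IsBlock D, .inr ⟨D, hD⟩ ∈ S ∧ v ∈ D.verts := by
  rw [shadow, Subgraph.verts_sSup, Set.mem_iUnion₂]
  constructor
  · rintro ⟨D, ⟨hD, hDS⟩, hv⟩
    exact ⟨D, hD, hDS, hv⟩
  · rintro ⟨D, hD, hDS, hv⟩
    exact ⟨D, ⟨hD, hDS⟩, hv⟩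

theorem IsBlock.exists_component {x : G.BCVertex} {D : G.Subgraph} (hD : G.IsBlock D)
    (hx : .inr ⟨D, hD⟩ ≠ x) : ∃ H ∈ G.articulationComponents x, D.verts ⊆ H.verts := by
  refine ⟨_, ⟨(G.bcTree.induce {x}ᶜ).connectedComponentMk ⟨_, hx⟩, rfl⟩, fun v hv => ?_⟩
  exact mem_shadow.2 ⟨D, hD, ⟨⟨_, hx⟩, rfl, rfl⟩, hv⟩

variable [Finite V]

theorem gate_eq_of_branchGraph_reachable (hG : G.Connected)
    {B : {B : G.Subgraph // G.IsBlock B}} {u v : V}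
    (h : (G.branchGraph (.inr B)).Reachable u v) :
    G.gate B.1.verts u = G.gate B.1.verts v := by
  obtain ⟨p⟩ := h
  induction p with
  | nil => rfl
  | cons hadj p ih =>
    exact (gate_eq_of_adj hG (B.2.pathConvex hG) B.2.nonempty hadj.1 hadj.2).trans ih

/-- Blocks other than the root stay connected in the branch graph: no articulation point separates
two other vertices of `D`, and a path within `D` has no edge in a different block. -/
theorem IsBlock.branchGraph_reachable (hG : G.Connected) {x : G.BCVertex} {D : G.Subgraph}
    (hD : G.IsBlock D) (hx : .inr ⟨D, hD⟩ ≠ x) {u v : V} (hu : u ∈ D.verts) (hv : v ∈ D.verts)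
    (hu' : u ∉ G.excluded x) (hv' : v ∉ G.excluded x) : (G.branchGraph x).Reachable u v := by
  rcases x with a | B
  · exact (connAvoiding_iff_branchGraph_reachable hu').1
      (hD.linked hG hu hv _ (fun h => hu' h.symm) (fun h => hv' h.symm))
  · obtain ⟨p, hp⟩ := hG.exists_isPath u v
    have hDp := hD.pathConvex hG u hu v hv p hp
    clear hp hu hv hu' hv'
    induction p with
    | nil => rfl
    | cons hadj p ih =>
      refine Reachable.trans (Adj.reachable ⟨hadj, fun h => hx ?_⟩)
        (ih fun w hw => hDp w (by simp [hw]))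
      rw [Sum.inr.injEq]
      exact Subtype.ext (hD.eq_of_mem_of_mem hG B.2 hadj.ne (hDp _ (by simp)) (hDp _ (by simp))
        h.1 h.2)

theorem branchGraph_reachable_of_mem_rootSubgraph (hG : G.Connected) {x y : G.BCVertex}
    (hy : y ≠ x) {u v : V} (hu : u ∈ (G.rootSubgraph y).verts) (hv : v ∈ (G.rootSubgraph y).verts)
    (hu' : u ∉ G.excluded x) (hv' : v ∉ G.excluded x) : (G.branchGraph x).Reachable u v := by
  rcases y with a | D
  · have hu : u = a.1 := hu
    have hv : v = a.1 := hv
    rw [hu, hv]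
  · exact D.2.branchGraph_reachable hG hy hu hv hu' hv'

/-- Adjacent vertices of the BC-tree share an articulation point that is not excluded, through which
a walk in the BC-tree is followed in `G`. The exclusion matters at an articulation point, which
belongs to all of its components. -/
theorem branchGraph_reachable_of_reachable (hG : G.Connected) {x : G.BCVertex}
    {y z : ↥({x}ᶜ : Set G.BCVertex)} (h : (G.bcTree.induce {x}ᶜ).Reachable y z) {u v : V}
    (hu : u ∈ (G.rootSubgraph y).verts) (hv : v ∈ (G.rootSubgraph z).verts)
    (hu' : u ∉ G.excluded x) (hv' : v ∉ G.excluded x) : (G.branchGraph x).Reachable u v := by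
  obtain ⟨p⟩ := h
  induction p generalizing u with
  | @nil y => exact branchGraph_reachable_of_mem_rootSubgraph hG y.2 hu hv hu' hv'
  | @cons y w z hadj p ih =>
    obtain ⟨c, hcy, hcw, hc⟩ := exists_mem_notMem_excluded_of_bcTree_adj hadj y.2 w.2
    exact (branchGraph_reachable_of_mem_rootSubgraph hG y.2 hu hcy hu' hc).trans (ih hcw hv hc)

/-- Every edge of the branch graph lies in a block other than the root. Two distinct blocks met at
the same non-excluded vertex are joined in the BC-tree through that articulation point, away from
`x`. -/
theorem reachable_of_branchGraph_reachable (hG : G.Connected) {x : G.BCVertex} {u v : V}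
    (h : (G.branchGraph x).Reachable u v) (hu' : u ∉ G.excluded x)
    {y z : ↥({x}ᶜ : Set G.BCVertex)} {B D : {B : G.Subgraph // G.IsBlock B}}
    (hy : y.1 = .inr B) (hz : z.1 = .inr D) (hu : u ∈ B.1.verts) (hv : v ∈ D.1.verts) :
    (G.bcTree.induce {x}ᶜ).Reachable y z := by
  have key : ∀ {u : V} {y z : ↥({x}ᶜ : Set G.BCVertex)} {B D : {B : G.Subgraph // G.IsBlock B}},
      u ∉ G.excluded x → y.1 = .inr B → z.1 = .inr D → u ∈ B.1.verts → u ∈ D.1.verts →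
      (G.bcTree.induce {x}ᶜ).Reachable y z := by
    intro u y z B D hu' hy hz hB hD
    by_cases hne : B = D
    · have : y = z := Subtype.ext (by rw [hy, hz, hne])
      rw [this]
    · have ha : G.IsArticulationPoint u := (isArticulationPoint_iff_exists_isBlock hG).2
        ⟨B, D, B.2, D.2, fun h => hne (Subtype.ext h), hB, hD⟩
      have hax : (.inl ⟨u, ha⟩ : G.BCVertex) ≠ x := by
        rintro rfl
        exact hu' rfl
      have h1 : (G.bcTree.induce {x}ᶜ).Adj y ⟨.inl ⟨u, ha⟩, hax⟩ := by
        change G.bcTree.Adj y.1 _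
        rw [hy]
        exact hB
      have h2 : (G.bcTree.induce {x}ᶜ).Adj ⟨.inl ⟨u, ha⟩, hax⟩ z := by
        change G.bcTree.Adj _ z.1
        rw [hz]
        exact hD
      exact h1.reachable.trans h2.reachable
  obtain ⟨p⟩ := h
  induction p generalizing y B with
  | nil => exact key hu' hy hz hu hv
  | @cons u w v hadj p ih =>
    obtain ⟨C, hC, hCadj⟩ := (branchGraph_le x hadj).exists_isBlock hG
    have hCx : (.inr ⟨C, hC⟩ : G.BCVertex) ≠ x := by
      rintro rfl
      exact hadj.2 ⟨C.edge_vert hCadj, C.edge_vert hCadj.symm⟩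
    exact (key (z := ⟨_, hCx⟩) hu' hy rfl hu (C.edge_vert hCadj)).trans
      (ih (notMem_excluded_of_adj hadj) (y := ⟨_, hCx⟩) rfl (C.edge_vert hCadj.symm) hv)

theorem branchGraph_reachable_of_mem_component (hG : G.Connected) {x : G.BCVertex}
    {H : G.Subgraph} (hH : H ∈ G.articulationComponents x) {u v : V} (hu : u ∈ H.verts)
    (hv : v ∈ H.verts) (hu' : u ∉ G.excluded x) (hv' : v ∉ G.excluded x) :
    (G.branchGraph x).Reachable u v := by
  obtain ⟨c, rfl⟩ := hH
  obtain ⟨B, hB, ⟨y, hy, hyB⟩, huB⟩ := mem_shadow.1 hu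
  obtain ⟨D, hD, ⟨z, hz, hzD⟩, hvD⟩ := mem_shadow.1 hv
  have hyz : (G.bcTree.induce {x}ᶜ).Reachable y z := by
    rw [ConnectedComponent.mem_supp_iff] at hy hz
    exact ConnectedComponent.exact (hy.trans hz.symm)
  refine branchGraph_reachable_of_reachable hG hyz ?_ ?_ hu' hv'
  · rw [hyB]
    exact huB
  · rw [hzD]
    exact hvD

theorem component_eq_of_branchGraph_reachable (hG : G.Connected) {x : G.BCVertex}
    {H H' : G.Subgraph} (hH : H ∈ G.articulationComponents x)
    (hH' : H' ∈ G.articulationComponents x) {u v : V} (hu : u ∈ H.verts) (hv : v ∈ H'.verts)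
    (hu' : u ∉ G.excluded x) (h : (G.branchGraph x).Reachable u v) : H = H' := by
  obtain ⟨c, rfl⟩ := hH
  obtain ⟨c', rfl⟩ := hH'
  obtain ⟨B, hB, ⟨y, hy, hyB⟩, huB⟩ := mem_shadow.1 hu
  obtain ⟨D, hD, ⟨z, hz, hzD⟩, hvD⟩ := mem_shadow.1 hv
  have hyz := reachable_of_branchGraph_reachable hG h hu' hyB hzD huB hvD
  rw [ConnectedComponent.mem_supp_iff] at hy hz
  have : c = c' := by
    rw [← hy, ← hz]
    exact ConnectedComponent.sound hyz
  rw [this]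

end SimpleGraph

/-! ### The pruned graph and the shape of its BC-tree. -/

namespace SimpleGraph

variable {V : Type*} {G : SimpleGraph V}

/-- The choice of farthest vertices and of geodesics to the root made in pruning `G` to `G'`. -/
structure Pruning (G : SimpleGraph V) (x : G.BCVertex) (G' : G.Subgraph) where
  /-- The chosen vertex of a component that is farthest from the root. -/
  far : G.articulationComponents x → V
  /-- The end of the chosen geodesic on the root. -/
  near : G.articulationComponents x → V
  /-- The chosen geodesic. -/
  walk : ∀ H, G.Walk (far H) (near H)
  far_mem : ∀ H, far H ∈ H.1.verts
  le_far : ∀ H, ∀ v ∈ H.1.verts, G.distTo (G.rootSubgraph x) v ≤ G.distTo (G.rootSubgraph x) (far H)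
  near_mem : ∀ H, near H ∈ (G.rootSubgraph x).verts
  length_eq : ∀ H, ((walk H).length : ℕ∞) = G.distTo (G.rootSubgraph x) (far H)
  eq : G' = G.rootSubgraph x ⊔ ⨆ H, ((walk H).toSubgraph ⊔
      sSup {D : G.Subgraph | G.IsBlock D ∧ ∃ e ∈ (walk H).edges, e ∈ D.edgeSet})

theorem IsPrunedAlong.exists_pruning {x : G.BCVertex} {G' : G.Subgraph}
    (h : G.IsPrunedAlong (G.rootSubgraph x) (G.articulationComponents x) G') :
    Nonempty (G.Pruning x G') := by
  obtain ⟨far, near, p, h1, h2, h3⟩ := h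
  exact ⟨⟨far, near, p, fun H => (h1 H).1, fun H => (h1 H).2, fun H => (h2 H).1,
    fun H => (h2 H).2, h3⟩⟩

namespace Pruning

variable {x : G.BCVertex} {G' : G.Subgraph} (P : G.Pruning x G')
include P

theorem root_le : G.rootSubgraph x ≤ G' := by
  rw [P.eq]
  exact le_sup_left

theorem walk_le (H : G.articulationComponents x) : (P.walk H).toSubgraph ≤ G' := by
  conv_rhs => rw [P.eq]
  exact le_sup_of_le_right (le_iSup_of_le H le_sup_left)

theorem block_le {D : G.Subgraph} (hD : G.IsBlock D) {H : G.articulationComponents x} {u v : V}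
    (he : s(u, v) ∈ (P.walk H).edges) (h : D.Adj u v) : D ≤ G' := by
  conv_rhs => rw [P.eq]
  exact le_sup_of_le_right (le_iSup_of_le H (le_sup_of_le_right (le_sSup ⟨hD, _, he, h⟩)))

theorem adj_cases {u v : V} (h : G'.Adj u v) : (G.rootSubgraph x).Adj u v ∨
    ∃ H, s(u, v) ∈ (P.walk H).edges ∨
      ∃ D, G.IsBlock D ∧ (∃ e ∈ (P.walk H).edges, e ∈ D.edgeSet) ∧ D.Adj u v := by
  rw [P.eq, Subgraph.sup_adj, Subgraph.iSup_adj] at h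
  refine h.imp_right fun ⟨H, h⟩ => ⟨H, ?_⟩
  rw [Subgraph.sup_adj, Walk.adj_toSubgraph_iff_mem_edges, Subgraph.sSup_adj] at h
  exact h.imp_right fun ⟨D, hD, h⟩ => ⟨D, hD.1, hD.2, h⟩

theorem mem_cases {v : V} (h : v ∈ G'.verts) : v ∈ (G.rootSubgraph x).verts ∨
    ∃ H, v ∈ (P.walk H).support ∨
      ∃ D, G.IsBlock D ∧ (∃ e ∈ (P.walk H).edges, e ∈ D.edgeSet) ∧ v ∈ D.verts := by
  rw [P.eq, Subgraph.verts_sup, Set.mem_union, Subgraph.verts_iSup, Set.mem_iUnion] at h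
  refine h.imp_right fun ⟨H, h⟩ => ⟨H, ?_⟩
  rw [Subgraph.verts_sup, Set.mem_union, Walk.mem_verts_toSubgraph, Subgraph.verts_sSup,
    Set.mem_iUnion₂] at h
  exact h.imp_right fun ⟨D, hD, h⟩ => ⟨D, hD.1, hD.2, h⟩

theorem far_mem_verts (H : G.articulationComponents x) : P.far H ∈ G'.verts :=
  (P.walk_le H).1 (Walk.start_mem_verts_toSubgraph _)

theorem isPath (hG : G.Connected) (H : G.articulationComponents x) : (P.walk H).IsPath := by
  apply Walk.isPath_of_length_eq_dist
  apply le_antisymm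
  · have := (P.length_eq H).trans_le (distTo_le_edist (P.near_mem H) (P.far H))
    rwa [← hG.coe_dist, Nat.cast_le, G.dist_comm] at this
  · exact G.dist_le _

variable [Finite V]

theorem block_le_of_gate_ne (hG : G.Connected) {D : G.Subgraph} (hD : G.IsBlock D)
    {H : G.articulationComponents x} (h : G.gate D.verts (P.far H) ≠ G.gate D.verts (P.near H)) :
    D ≤ G' := by
  obtain ⟨u, v, he, hu, hv⟩ := exists_mem_edges_of_gate_ne hG (hD.pathConvex hG) hD.nonempty
    (P.walk H) h
  exact P.block_le hD he ((hD.adj_iff hG).2 ⟨hu, hv, (P.walk H).adj_of_mem_edges he⟩)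

omit P in
theorem gate_eq_of_mem_root (hG : G.Connected) {D : G.Subgraph} (hD : G.IsBlock D)
    (hx : .inr ⟨D, hD⟩ ≠ x) {u v : V} (hu : u ∈ (G.rootSubgraph x).verts)
    (hv : v ∈ (G.rootSubgraph x).verts) : G.gate D.verts u = G.gate D.verts v := by
  rcases x with a | B
  · have hu : u = a.1 := hu
    have hv : v = a.1 := hv
    rw [hu, hv]
  · exact hD.gate_eq_gate hG B.2 (fun h => hx (congrArg Sum.inr (Subtype.ext h))) hu hv

omit P in
theorem root_connected (x : G.BCVertex) : (G.rootSubgraph x).Connected := by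
  rcases x with a | B
  · exact Subgraph.singletonSubgraph_connected
  · exact Subgraph.connected_iff'.2 (isNonseparable_iff.1 B.2.prop).1

theorem connected : G'.Connected := by
  rw [Subgraph.connected_iff_forall_exists_walk_subgraph]
  have hroot := root_connected x
  obtain ⟨r, hr⟩ := hroot.nonempty
  refine ⟨⟨r, P.root_le.1 hr⟩, ?_⟩
  have key : ∀ v ∈ G'.verts, ∃ C : G.Subgraph, C.Connected ∧ C ≤ G' ∧ r ∈ C.verts ∧
      v ∈ C.verts := by
    intro v hv
    have hwalk : ∀ H, (G.rootSubgraph x ⊔ (P.walk H).toSubgraph).Connected := fun H =>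
      Subgraph.connected_sup hroot.preconnected (P.walk H).toSubgraph_connected.preconnected
        ⟨P.near H, P.near_mem H, Walk.end_mem_verts_toSubgraph _⟩
    rcases P.mem_cases hv with hv | ⟨H, hv | ⟨D, hD, ⟨e, he, heD⟩, hv⟩⟩
    · exact ⟨_, hroot, P.root_le, hr, hv⟩
    · exact ⟨_, hwalk H, sup_le P.root_le (P.walk_le H), .inl hr,
        .inr ((P.walk H).mem_verts_toSubgraph.2 hv)⟩
    · induction e using Sym2.ind with | _ y z
      refine ⟨_, Subgraph.connected_sup (hwalk H).preconnected
        (Subgraph.connected_iff'.2 (isNonseparable_iff.1 hD.prop).1).preconnected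
        ⟨y, .inr ?_, D.edge_vert heD⟩,
        sup_le (sup_le P.root_le (P.walk_le H)) (P.block_le hD he heD), .inl (.inl hr), .inr hv⟩
      exact (P.walk H).mem_verts_toSubgraph.2 (Walk.fst_mem_support_of_mem_edges _ he)
  intro u v hu hv
  obtain ⟨C, hC, hCle, hrC, huC⟩ := key u hu
  obtain ⟨C', hC', hCle', hrC', hvC'⟩ := key v hv
  obtain ⟨p, hp⟩ := (C.connected_iff_forall_exists_walk_subgraph.1 hC).2 huC hrC
  obtain ⟨q, hq⟩ := (C'.connected_iff_forall_exists_walk_subgraph.1 hC').2 hrC' hvC'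
  refine ⟨p.append q, ?_⟩
  rw [Walk.toSubgraph_append]
  exact sup_le (hp.trans hCle) (hq.trans hCle')

/-- Only the root needs a hypothesis: a root consisting of a single articulation point is not itself
covered by a block of the construction, whereas every edge of a geodesic brings its block along. -/
theorem isBlockUnion_of_forall_root (hG : G.Connected)
    (hroot : ∀ v ∈ (G.rootSubgraph x).verts, ∃ D, G.IsBlock D ∧ D ≤ G' ∧ v ∈ D.verts) :
    G'.IsBlockUnion := by
  refine ⟨P.connected, fun v hv => ?_, fun u v h => ?_⟩
  · rcases P.mem_cases hv with hv | ⟨H, hv | ⟨D, hD, ⟨e, he, heD⟩, hv⟩⟩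
    · exact hroot v hv
    · by_cases hnil : (P.walk H).Nil
      · refine hroot v ?_
        rw [Walk.nil_iff_support_eq] at hnil
        rw [hnil, List.mem_singleton] at hv
        have := (P.walk H).end_mem_support
        rw [hnil, List.mem_singleton] at this
        rw [hv, ← this]
        exact P.near_mem H
      · rw [Walk.mem_support_iff_exists_mem_edges_of_not_nil hnil] at hv
        obtain ⟨e, he, hve⟩ := hv
        obtain ⟨w, rfl⟩ := Sym2.mem_iff_exists.1 hve
        obtain ⟨D, hD, hadj⟩ := ((P.walk H).adj_of_mem_edges he).exists_isBlock hG
        exact ⟨D, hD, P.block_le hD he hadj, D.edge_vert hadj⟩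
    · induction e using Sym2.ind with | _ y z
      exact ⟨D, hD, P.block_le hD he heD, hv⟩
  · rcases P.adj_cases h with h | ⟨H, he | ⟨D, hD, ⟨e, he, heD⟩, h⟩⟩
    · rcases x with a | B
      · exact absurd h (by simp [rootSubgraph])
      · exact ⟨B.1, B.2, P.root_le, h⟩
    · obtain ⟨D, hD, hadj⟩ := ((P.walk H).adj_of_mem_edges he).exists_isBlock hG
      exact ⟨D, hD, P.block_le hD he hadj, hadj⟩
    · induction e using Sym2.ind with | _ y z
      exact ⟨D, hD, P.block_le hD he heD, h⟩

/-- A block of the pruned graph is the root or contains a step of one of the geodesics. -/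
theorem exists_gate_ne (hG : G.Connected) {D : G.Subgraph} (hD : G.IsBlock D)
    (hx : .inr ⟨D, hD⟩ ≠ x) (hle : D ≤ G') {u v : V} (hu : u ∈ D.verts) (hv : v ∈ D.verts)
    (huv : u ≠ v) {r : V} (hr : r ∈ (G.rootSubgraph x).verts) :
    ∃ H, G.gate D.verts (P.far H) ≠ G.gate D.verts r := by
  obtain ⟨w, hw⟩ := hD.exists_adj hG hu hv huv
  have key : ∀ H y z, s(y, z) ∈ (P.walk H).edges → D.Adj y z →
      ∃ H, G.gate D.verts (P.far H) ≠ G.gate D.verts r := by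
    intro H y z he hyz
    refine ⟨H, ?_⟩
    rw [gate_eq_of_mem_root hG hD hx hr (P.near_mem H)]
    exact (P.isPath hG H).gate_ne hG (hD.pathConvex hG) he (D.edge_vert hyz)
      (D.edge_vert hyz.symm)
  rcases P.adj_cases (hle.2 hw) with h | ⟨H, he | ⟨C, hC, ⟨e, he, heD⟩, h⟩⟩
  · rcases x with a | B
    · exact absurd h (by simp [rootSubgraph])
    · exact absurd (congrArg Sum.inr (Subtype.ext (hD.eq_of_adj hG B.2 hw h))) hx
  · exact key H _ _ he hw
  · induction e using Sym2.ind with | _ y z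
    have : C = D := hC.eq_of_adj hG hD h hw
    exact key H y z he (this ▸ heD)

theorem reachable_of_gate_ne (hG : G.Connected) {D : G.Subgraph} (hD : G.IsBlock D)
    (hx : .inr ⟨D, hD⟩ ≠ x) {H : G.articulationComponents x} {r : V}
    (hr : r ∈ (G.rootSubgraph x).verts) (h : G.gate D.verts (P.far H) ≠ G.gate D.verts r)
    {c : V} (hc : c ∈ D.verts) (hcx : c ∉ G.excluded x) :
    (G.branchGraph x).Reachable (P.far H) c := by
  classical
  obtain ⟨p, -, hp⟩ := exists_walk_gate hG D.verts (P.far H)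
  -- If the way from the far vertex to `D` met the root, its continuation to `D` would show that far
  -- vertex and root have the same gate.
  have hroot : ∀ z ∈ p.support, z ∉ (G.rootSubgraph x).verts := by
    intro z hz hzr
    apply h
    rw [gate_eq_of_mem_root hG hD hx hr hzr]
    have := gate_mem_support hG (hD.pathConvex hG) (gate_mem hD.nonempty (P.far H))
      (p.dropUntil z hz)
    exact (hp _ (p.support_dropUntil_subset_support hz this) (gate_mem hD.nonempty z)).symm
  have hg : G.gate D.verts (P.far H) ∉ G.excluded x := fun hc =>
    hroot _ p.end_mem_support (excluded_subset x hc)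
  exact (branchGraph_reachable_of_walk p hroot).trans
    (hD.branchGraph_reachable hG hx (gate_mem hD.nonempty _) hc hg hcx)

/-- Both far vertices reach `c` in the branch graph, so they lie in the same component. As each
component has one geodesic, this is what prevents branching away from the root. -/
theorem component_eq (hG : G.Connected) {D₁ D₂ : G.Subgraph} (hD₁ : G.IsBlock D₁)
    (hD₂ : G.IsBlock D₂) (hx₁ : .inr ⟨D₁, hD₁⟩ ≠ x) (hx₂ : .inr ⟨D₂, hD₂⟩ ≠ x)
    {H₁ H₂ : G.articulationComponents x} {r : V} (hr : r ∈ (G.rootSubgraph x).verts)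
    (h₁ : G.gate D₁.verts (P.far H₁) ≠ G.gate D₁.verts r)
    (h₂ : G.gate D₂.verts (P.far H₂) ≠ G.gate D₂.verts r)
    {c : V} (hc₁ : c ∈ D₁.verts) (hc₂ : c ∈ D₂.verts) (hcx : c ∉ G.excluded x) : H₁ = H₂ := by
  have hr₁ := P.reachable_of_gate_ne hG hD₁ hx₁ hr h₁ hc₁ hcx
  have hr₂ := P.reachable_of_gate_ne hG hD₂ hx₂ hr h₂ hc₂ hcx
  exact Subtype.ext (component_eq_of_branchGraph_reachable hG H₁.2 H₂.2 (P.far_mem H₁)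
    (P.far_mem H₂) (notMem_excluded_of_reachable hr₁.symm hcx) (hr₁.trans hr₂.symm))

/-- Of the blocks at a vertex, the pruned graph contains at most one that leads away from the
root. -/
theorem eq_of_gate_root_eq (hG : G.Connected) {D₁ D₂ : G.Subgraph} (hD₁ : G.IsBlock D₁)
    (hD₂ : G.IsBlock D₂) (hx₁ : .inr ⟨D₁, hD₁⟩ ≠ x) (hx₂ : .inr ⟨D₂, hD₂⟩ ≠ x)
    (hle₁ : D₁ ≤ G') (hle₂ : D₂ ≤ G') {r : V} (hr : r ∈ (G.rootSubgraph x).verts) {c : V}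
    (hc₁ : c ∈ D₁.verts) (hc₂ : c ∈ D₂.verts) (hcx : c ∉ G.excluded x)
    (h₁ : G.gate D₁.verts r = c) (h₂ : G.gate D₂.verts r = c) : D₁ = D₂ := by
  by_contra hne
  obtain ⟨u, hu, huc⟩ := hD₁.exists_ne hG hD₂ hne hc₂
  obtain ⟨v, hv, hvc⟩ := hD₂.exists_ne hG hD₁ (Ne.symm hne) hc₁
  obtain ⟨H₁, hH₁⟩ := P.exists_gate_ne hG hD₁ hx₁ hle₁ hu hc₁ huc hr
  obtain ⟨H₂, hH₂⟩ := P.exists_gate_ne hG hD₂ hx₂ hle₂ hv hc₂ hvc hr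
  obtain rfl := P.component_eq hG hD₁ hD₂ hx₁ hx₂ hr hH₁ hH₂ hc₁ hc₂ hcx
  rw [h₁] at hH₁
  rw [h₂] at hH₂
  exact (hD₁.gate_eq_or_gate_eq hG hD₂ hne hc₁ hc₂ (P.far H₁)).elim hH₁ hH₂

omit P in
/-- Of the blocks at a vertex, at most one leads to the root. -/
theorem eq_of_gate_root_ne (hG : G.Connected) {D₁ D₂ : G.Subgraph} (hD₁ : G.IsBlock D₁)
    (hD₂ : G.IsBlock D₂) {r : V} (hr : r ∈ (G.rootSubgraph x).verts) {c : V}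
    (hc₁ : c ∈ D₁.verts) (hc₂ : c ∈ D₂.verts)
    (h₁ : ¬ (.inr ⟨D₁, hD₁⟩ ≠ x ∧ G.gate D₁.verts r = c))
    (h₂ : ¬ (.inr ⟨D₂, hD₂⟩ ≠ x ∧ G.gate D₂.verts r = c)) : D₁ = D₂ := by
  by_contra hne
  have key : ∀ {D₁ D₂ : G.Subgraph} (hD₁ : G.IsBlock D₁) (hD₂ : G.IsBlock D₂), D₁ ≠ D₂ →
      c ∈ D₁.verts → c ∈ D₂.verts → .inr ⟨D₁, hD₁⟩ = x →
      (.inr ⟨D₂, hD₂⟩ ≠ x ∧ G.gate D₂.verts r = c) := by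
    rintro D₁ D₂ hD₁ hD₂ hne hc₁ hc₂ rfl
    refine ⟨fun h => hne ?_, ?_⟩
    · exact (Subtype.mk.inj (Sum.inr.inj h)).symm
    · rw [hD₂.gate_eq_gate hG hD₁ (Ne.symm hne) hr hc₁, gate_of_mem hG (hD₂.pathConvex hG) hc₂]
  by_cases hx₁ : .inr ⟨D₁, hD₁⟩ = x
  · exact h₂ (key hD₁ hD₂ hne hc₁ hc₂ hx₁)
  by_cases hx₂ : .inr ⟨D₂, hD₂⟩ = x
  · exact h₁ (key hD₂ hD₁ (Ne.symm hne) hc₂ hc₁ hx₂)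
  exact (hD₁.gate_eq_or_gate_eq hG hD₂ hne hc₁ hc₂ r).elim (fun h => h₁ ⟨hx₁, h⟩)
    (fun h => h₂ ⟨hx₂, h⟩)

/-- A block of the pruned graph other than the root has at most one articulation point besides
the one leading to the root. -/
theorem eq_of_gate_root_ne_of_mem (hG : G.Connected) {D D₁ D₂ : G.Subgraph} (hD : G.IsBlock D)
    (hD₁ : G.IsBlock D₁) (hD₂ : G.IsBlock D₂) (hx : .inr ⟨D, hD⟩ ≠ x) (hne₁ : D ≠ D₁)
    (hne₂ : D ≠ D₂) (hle₁ : D₁ ≤ G') (hle₂ : D₂ ≤ G') {r : V}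
    (hr : r ∈ (G.rootSubgraph x).verts) {c₁ c₂ : V} (hc₁ : c₁ ∈ D.verts) (hc₁' : c₁ ∈ D₁.verts)
    (hc₂ : c₂ ∈ D.verts) (hc₂' : c₂ ∈ D₂.verts) (h₁ : G.gate D.verts r ≠ c₁)
    (h₂ : G.gate D.verts r ≠ c₂) : c₁ = c₂ := by
  have hroot : ∀ c ∈ D.verts, G.gate D.verts r ≠ c → c ∉ (G.rootSubgraph x).verts := by
    intro c hc h hcr
    apply h
    rw [gate_eq_of_mem_root hG hD hx hr hcr, gate_of_mem hG (hD.pathConvex hG) hc]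
  -- The further block `D'` at `c` is retained because of some geodesic. Its far vertex lies beyond
  -- `c` as seen from `D`, so its gate in `D` is `c`.
  have key : ∀ {D' c}, G.IsBlock D' → D ≠ D' → D' ≤ G' → c ∈ D.verts → c ∈ D'.verts →
      G.gate D.verts r ≠ c → ∃ H, G.gate D.verts (P.far H) = c := by
    intro D' c hD' hne hle hc hc' h
    have hx' : .inr ⟨D', hD'⟩ ≠ x := by
      rintro rfl
      exact hroot c hc h hc'
    obtain ⟨v, hv, hvc⟩ := hD'.exists_ne hG hD hne.symm hc
    obtain ⟨H, hH⟩ := P.exists_gate_ne hG hD' hx' hle hv hc' hvc hr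
    have h1 := (hD.gate_eq_or_gate_eq hG hD' hne hc hc' r).resolve_left h
    rw [h1] at hH
    exact ⟨H, (hD.gate_eq_or_gate_eq hG hD' hne hc hc' (P.far H)).resolve_right hH⟩
  obtain ⟨H₁, hH₁⟩ := key hD₁ hne₁ hle₁ hc₁ hc₁' h₁
  obtain ⟨H₂, hH₂⟩ := key hD₂ hne₂ hle₂ hc₂ hc₂' h₂
  have := P.component_eq hG hD hD hx hx hr (H₁ := H₁) (H₂ := H₂) (by rw [hH₁]; exact h₁.symm)
    (by rw [hH₂]; exact h₂.symm) hc₁ hc₁ (fun h => hroot c₁ hc₁ h₁ (excluded_subset x h))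
  rw [← hH₁, ← hH₂, this]

theorem bcVertexMap_eq (hG : G.Connected) (hG' : G'.IsBlockUnion) {t : G'.coe.BCVertex}
    (ht : 2 < (G'.coe.bcTree.neighborSet t).encard) : hG'.bcVertexMap hG t = x := by
  by_contra hne
  obtain ⟨r, hr⟩ := (root_connected x).nonempty
  obtain ⟨t₁, t₂, t₃, h₁, h₂, h₃, h₁₂, h₁₃, h₂₃⟩ := two_lt_encard_iff.1 ht
  rw [mem_neighborSet] at h₁ h₂ h₃
  rcases t with c | D
  · have hc : c.1.1 ∉ G.excluded x := by
      rcases x with a | B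
      · intro h
        exact hne (congrArg Sum.inl (Subtype.ext h))
      · exact fun h => h
    have hmem : ∀ B : {B : G'.coe.Subgraph // G'.coe.IsBlock B}, c.1 ∈ B.1.verts →
        c.1.1 ∈ (Subgraph.coeSubgraph B.1).verts := fun B h => ⟨c.1, h, rfl⟩
    have hinj : ∀ B B' : {B : G'.coe.Subgraph // G'.coe.IsBlock B},
        Subgraph.coeSubgraph B.1 = Subgraph.coeSubgraph B'.1 →
        (.inr B : G'.coe.BCVertex) = .inr B' := fun B B' h =>
      congrArg Sum.inr (Subtype.ext (Subgraph.coeSubgraph_injective G' h))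
    rcases t₁ with a₁ | B₁
    · exact h₁.elim
    rcases t₂ with a₂ | B₂
    · exact h₂.elim
    rcases t₃ with a₃ | B₃
    · exact h₃.elim
    -- Of two distinct blocks at `c` exactly one leads away from the root, which is impossible for
    -- three pairwise distinct blocks.
    have key : ∀ B B' : {B : G'.coe.Subgraph // G'.coe.IsBlock B}, c.1 ∈ B.1.verts →
        c.1 ∈ B'.1.verts → (.inr B : G'.coe.BCVertex) ≠ .inr B' →
        ((.inr ⟨_, hG'.isBlock_coeSubgraph hG B.2⟩ ≠ x ∧
          G.gate (Subgraph.coeSubgraph B.1).verts r = c.1.1) ↔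
        ¬ (.inr ⟨_, hG'.isBlock_coeSubgraph hG B'.2⟩ ≠ x ∧
          G.gate (Subgraph.coeSubgraph B'.1).verts r = c.1.1)) := by
      intro B B' hB hB' hBB'
      constructor
      · rintro ⟨h1, h2⟩ ⟨h3, h4⟩
        exact hBB' (hinj B B' (P.eq_of_gate_root_eq hG _ _ h1 h3 (Subgraph.coeSubgraph_le _)
          (Subgraph.coeSubgraph_le _) hr (hmem B hB) (hmem B' hB') hc h2 h4))
      · intro h'
        by_contra h
        exact hBB' (hinj B B' (eq_of_gate_root_ne hG _ _ hr (hmem B hB) (hmem B' hB') h h'))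
    have k₁ := key B₁ B₂ h₁ h₂ h₁₂
    have k₂ := key B₁ B₃ h₁ h₃ h₁₃
    have k₃ := key B₂ B₃ h₂ h₃ h₂₃
    tauto
  · rcases t₁ with c₁ | B₁
    swap
    · exact h₁.elim
    rcases t₂ with c₂ | B₂
    swap
    · exact h₂.elim
    rcases t₃ with c₃ | B₃
    swap
    · exact h₃.elim
    have hex : ∀ c : {a : G'.verts // G'.coe.IsArticulationPoint a}, ∃ D',
        G.IsBlock D' ∧ Subgraph.coeSubgraph D.1 ≠ D' ∧ D' ≤ G' ∧ c.1.1 ∈ D'.verts := by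
      intro c
      obtain ⟨E, F, hE, hF, hEF, hcE, hcF⟩ :=
        (isArticulationPoint_iff_exists_isBlock hG'.connected.coe).1 c.2
      by_cases h : D.1 = E
      · exact ⟨_, hG'.isBlock_coeSubgraph hG hF,
          fun h' => hEF (h ▸ Subgraph.coeSubgraph_injective G' h'), Subgraph.coeSubgraph_le _,
          ⟨c.1, hcF, rfl⟩⟩
      · exact ⟨_, hG'.isBlock_coeSubgraph hG hE,
          fun h' => h (Subgraph.coeSubgraph_injective G' h'), Subgraph.coeSubgraph_le _,
          ⟨c.1, hcE, rfl⟩⟩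
    -- At most one articulation point of `D` differs from the gate of the root; with the gate itself
    -- this leaves at most two neighbours.
    have key : ∀ c c' : {a : G'.verts // G'.coe.IsArticulationPoint a}, c.1 ∈ D.1.verts →
        c'.1 ∈ D.1.verts → (.inl c : G'.coe.BCVertex) ≠ .inl c' →
        G.gate (Subgraph.coeSubgraph D.1).verts r ≠ c.1.1 →
        G.gate (Subgraph.coeSubgraph D.1).verts r ≠ c'.1.1 → False := by
      intro c c' hc hc' hcc' h h'
      obtain ⟨E, hE, hne₁, hle₁, hcE⟩ := hex c
      obtain ⟨E', hE', hne₂, hle₂, hcE'⟩ := hex c'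
      refine hcc' (congrArg Sum.inl (Subtype.ext (Subtype.ext ?_)))
      exact P.eq_of_gate_root_ne_of_mem hG (hG'.isBlock_coeSubgraph hG D.2) hE hE' hne hne₁ hne₂
        hle₁ hle₂ hr ⟨c.1, hc, rfl⟩ hcE ⟨c'.1, hc', rfl⟩ hcE' h h'
    have hval : ∀ c c' : {a : G'.verts // G'.coe.IsArticulationPoint a},
        (.inl c : G'.coe.BCVertex) ≠ .inl c' → c.1.1 ≠ c'.1.1 := fun c c' h h' =>
      h (congrArg Sum.inl (Subtype.ext (Subtype.ext h')))
    by_cases e₁ : G.gate (Subgraph.coeSubgraph D.1).verts r = c₁.1.1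
    · refine key c₂ c₃ h₂ h₃ h₂₃ ?_ ?_
      · rw [e₁]
        exact hval _ _ h₁₂
      · rw [e₁]
        exact hval _ _ h₁₃
    by_cases e₂ : G.gate (Subgraph.coeSubgraph D.1).verts r = c₂.1.1
    · refine key c₁ c₃ h₁ h₃ h₁₃ e₁ ?_
      rw [e₂]
      exact hval _ _ h₂₃
    exact key c₁ c₂ h₁ h₂ h₁₂ e₁ e₂

theorem isPathShaped_or_isStarlike (hG : G.Connected) (hG' : G'.IsBlockUnion) :
    G'.coe.bcTree.IsPathShaped ∨ G'.coe.bcTree.IsStarlike :=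
  (bcTree_isTree hG'.connected.coe).isPathShaped_or_isStarlike fun _ _ hu hv =>
    hG'.bcVertexMap_injective hG
      ((P.bcVertexMap_eq hG hG' hu).trans (P.bcVertexMap_eq hG hG' hv).symm)

end Pruning

end SimpleGraph

namespace SimpleGraph

variable {V : Type*} {G : SimpleGraph V}

theorem distTo_singletonSubgraph (a v : V) :
    G.distTo (G.singletonSubgraph a) v = G.edist a v := by
  simp [distTo]

variable [Finite V]

theorem exists_distTo_eq_blockEccent (hG : G.Connected) (B : G.Subgraph) :
    ∃ v, G.distTo B v = G.blockEccent B := by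
  have := hG.nonempty
  exact exists_eq_ciSup_of_finite

/-! ### Existence of a pruning. -/

section Existence

/-- A component of the BC-tree without `x` contains a block, because an articulation point lies in
two blocks and at most one of them is `x`. -/
theorem nonempty_of_mem_articulationComponents (hG : G.Connected) {x : G.BCVertex}
    {H : G.Subgraph} (hH : H ∈ G.articulationComponents x) : H.verts.Nonempty := by
  obtain ⟨c, rfl⟩ := hH
  induction c using ConnectedComponent.ind with | _ y
  obtain ⟨D, hDx, hD⟩ : ∃ D : {B : G.Subgraph // G.IsBlock B}, ∃ h : .inr D ≠ x,
      (G.bcTree.induce {x}ᶜ).connectedComponentMk ⟨.inr D, h⟩ =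
        (G.bcTree.induce {x}ᶜ).connectedComponentMk y := by
    obtain ⟨a | D, hy⟩ := y
    · obtain ⟨B, D, hB, hD, hne, haB, haD⟩ := (isArticulationPoint_iff_exists_isBlock hG).1 a.2
      have key : ∀ E : {B : G.Subgraph // G.IsBlock B}, a.1 ∈ E.1.verts → .inr E ≠ x →
          ∃ D : {B : G.Subgraph // G.IsBlock B}, ∃ h : .inr D ≠ x,
            (G.bcTree.induce {x}ᶜ).connectedComponentMk ⟨.inr D, h⟩ =
              (G.bcTree.induce {x}ᶜ).connectedComponentMk ⟨.inl a, hy⟩ := by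
        intro E haE hE
        have hadj : (G.bcTree.induce {x}ᶜ).Adj ⟨.inr E, hE⟩ ⟨.inl a, hy⟩ := haE
        exact ⟨E, hE, ConnectedComponent.connectedComponentMk_eq_of_adj hadj⟩
      by_cases hx : .inr ⟨B, hB⟩ = x
      · refine key ⟨D, hD⟩ haD ?_
        rintro rfl
        exact hne (Subtype.mk.inj (Sum.inr.inj hx))
      · exact key ⟨B, hB⟩ haB hx
    · exact ⟨D, hy, rfl⟩
  obtain ⟨v, hv⟩ := D.2.nonempty
  exact ⟨v, mem_shadow.2 ⟨D.1, D.2, ⟨⟨_, hDx⟩, hD, rfl⟩, hv⟩⟩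

theorem exists_isPrunedAlong (hG : G.Connected) {R : G.Subgraph} (hR : R.verts.Nonempty)
    {comps : Set G.Subgraph} (hc : ∀ H ∈ comps, H.verts.Nonempty) :
    ∃ G', G.IsPrunedAlong R comps G' := by
  have hfar : ∀ H : comps, ∃ f ∈ H.1.verts, ∀ v ∈ H.1.verts, G.distTo R v ≤ G.distTo R f :=
    fun H => Set.exists_max_image _ (G.distTo R) (Set.toFinite _) (hc H.1 H.2)
  choose far hfar using hfar
  have hwalk : ∀ H : comps, ∃ p : G.Walk (far H) (G.gate R.verts (far H)),
      (p.length : ℕ∞) = G.distTo R (far H) := by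
    intro H
    obtain ⟨p, -, hp⟩ := hG.exists_path_of_dist (far H) (G.gate R.verts (far H))
    exact ⟨p, by rw [hp, distTo_eq hG hR, G.dist_comm]⟩
  choose p hp using hwalk
  exact ⟨_, far, fun H => G.gate R.verts (far H), p, hfar, fun H => ⟨gate_mem hR _, hp H⟩, rfl⟩

theorem exists_isPruning (hG : G.Connected) : ∃ G', G.IsPruning G' := by
  have := hG.nonempty
  by_cases hA : G.IsTypeA
  · obtain ⟨a, ha⟩ := G.center_nonempty
    obtain ⟨G', h⟩ := exists_isPrunedAlong hG (R := G.singletonSubgraph a) ⟨a, rfl⟩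
      (comps := G.articulationComponentsAtPoint a)
      fun H ⟨_, hH⟩ => nonempty_of_mem_articulationComponents hG hH
    exact ⟨G', .inl ⟨hA, a, ha, h⟩⟩
  · obtain ⟨v⟩ := this
    obtain ⟨B₀, hB₀, -⟩ := exists_isBlock_mem hG v
    obtain ⟨B, hB, hmin⟩ := Set.exists_min_image {B : G.Subgraph | G.IsBlock B} G.blockEccent
      (Set.toFinite _) ⟨B₀, hB₀⟩
    have hBc : B ∈ G.centralBlocks :=
      ⟨hB, le_antisymm (le_iInf₂ hmin) (blockRadius_le hB)⟩
    obtain ⟨G', h⟩ := exists_isPrunedAlong hG hB.nonempty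
      (comps := G.articulationComponentsAtBlock B)
      fun H ⟨_, hH⟩ => nonempty_of_mem_articulationComponents hG hH
    exact ⟨G', .inr ⟨hA, B, hBc, h⟩⟩

end Existence

namespace Subgraph

variable {H : G.Subgraph}

theorem IsBlockUnion.eccent_coe_le (hG : G.Connected) (hH : H.IsBlockUnion) (v : H.verts) :
    H.coe.eccent v ≤ G.eccent v := by
  rw [eccent_le_iff]
  intro w
  rw [hH.edist_coe hG]
  exact edist_le_eccent

theorem IsBlockUnion.ediam_coe_le (hG : G.Connected) (hH : H.IsBlockUnion) :
    H.coe.ediam ≤ G.ediam := by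
  rw [ediam_le_iff]
  intro u v
  rw [hH.edist_coe hG]
  exact edist_le_ediam

theorem IsBlockUnion.periphery_coe_subset (hG : G.Connected) (hH : H.IsBlockUnion)
    (h : H.coe.ediam = G.ediam) : Subtype.val '' H.coe.periphery ⊆ G.periphery := by
  rintro _ ⟨v, hv, rfl⟩
  have hv : H.coe.eccent v = H.coe.ediam := hv
  refine le_antisymm eccent_le_ediam ?_
  rw [← h, ← hv]
  exact hH.eccent_coe_le hG v

end Subgraph

/-- The eccentricity data of a subgraph agree with those of the graph. -/
structure SameEccentricityData (G : SimpleGraph V) (G' : G.Subgraph) : Prop where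
  center : Subtype.val '' G'.coe.center = G.center
  centralBlocks : SimpleGraph.Subgraph.coeSubgraph '' G'.coe.centralBlocks = G.centralBlocks
  radius : G'.coe.radius = G.radius
  blockRadius : G'.coe.blockRadius = G.blockRadius
  ediam : G'.coe.ediam = G.ediam

/-! ### Type A: two poles on different sides of the central point. -/

section TypeA

theorem sameEccentricityData_of_bipolar (hG : G.Connected) {G' : G.Subgraph}
    (hG' : G'.IsBlockUnion) {a f₁ f₂ : V} {r : ℕ} (hr : ∀ v, G.dist a v ≤ r)
    (h₁ : G.dist a f₁ = r) (h₂ : G.dist a f₂ = r) (hs : ¬ G.ConnAvoiding a f₁ f₂)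
    (ha : a ∈ G'.verts) (hf₁ : f₁ ∈ G'.verts) (hf₂ : f₂ ∈ G'.verts)
    (hblock : ∀ D, G.IsBlock D → a ∈ D.verts → D ≤ G') : G.SameEccentricityData G' := by
  obtain ⟨hc, hrad, hdiam, hbrad, hcb⟩ := center_of_bipolar hG hr h₁ h₂ hs
  obtain ⟨hc', hrad', hdiam', hbrad', hcb'⟩ := center_of_bipolar hG'.connected.coe
    (a := ⟨a, ha⟩) (f₁ := ⟨f₁, hf₁⟩) (f₂ := ⟨f₂, hf₂⟩) (r := r)
    (fun v => by rw [hG'.dist_coe hG]; exact hr v) (by rw [hG'.dist_coe hG]; exact h₁)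
    (by rw [hG'.dist_coe hG]; exact h₂) (Subgraph.not_connAvoiding_coe hs)
  refine ⟨?_, ?_, by rw [hrad, hrad'], by rw [hbrad, hbrad'], by rw [hdiam, hdiam']⟩
  · rw [hc, hc', Set.image_singleton]
  · rw [hcb, hcb']
    ext D
    constructor
    · rintro ⟨C, ⟨hC, haC⟩, rfl⟩
      exact ⟨hG'.isBlock_coeSubgraph hG hC, ⟨_, haC, rfl⟩⟩
    · rintro ⟨hD, haD⟩
      have hle := hblock D hD haD
      exact ⟨G'.restrict D, ⟨Subgraph.isBlock_restrict hD hle, haD⟩,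
        Subgraph.coeSubgraph_restrict_of_le hle⟩

/-- Each block `B` at `a` has eccentricity at least `r = ecc a`, so some vertex is at distance `r`
from `B`, which is only possible with gate `a`. Take any vertex at distance `r` from `a` and apply
this to the block leading towards it. If `r = 0`, both poles are `a`. -/
theorem IsTypeA.exists_poles (hG : G.Connected) (hA : G.IsTypeA) {a : V} (ha : a ∈ G.center) :
    ∃ r : ℕ, (∀ v, G.dist a v ≤ r) ∧ ∃ f₁ f₂, G.dist a f₁ = r ∧ G.dist a f₂ = r ∧
      ¬ G.ConnAvoiding a f₁ f₂ := by
  obtain ⟨v₀, hv₀⟩ := exists_dist_eq_eccent hG a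
  have hr : ∀ v, G.dist a v ≤ G.dist a v₀ := by
    intro v
    have := hG.dist_le_eccent a v
    rwa [← hv₀, Nat.cast_le] at this
  have hB : ∀ B, G.IsBlock B → a ∈ B.verts →
      ∃ v, G.dist a v = G.dist a v₀ ∧ G.gate B.verts v = a := by
    intro B hB haB
    obtain ⟨v, hv⟩ := exists_distTo_eq_blockEccent hG B
    have h1 := blockRadius_le hB
    rw [hA, ← (G.mem_center_iff a).1 ha, ← hv₀, ← hv, distTo_eq hG hB.nonempty, Nat.cast_le] at h1
    have h2 := dist_eq_add_gate hG (hB.pathConvex hG) (v := v) haB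
    have h3 := hr v
    rw [G.dist_comm (u := v) (v := a), G.dist_comm (u := v)] at h2
    have h4 : G.gate B.verts v = a := hG.dist_eq_zero_iff.1 (by omega)
    exact ⟨v, by omega, h4⟩
  refine ⟨G.dist a v₀, hr, ?_⟩
  by_cases hva : v₀ = a
  · subst hva
    exact ⟨v₀, v₀, rfl, rfl, fun ⟨p, hp⟩ => hp p.start_mem_support⟩
  · obtain ⟨B, hB', haB, hgB⟩ := exists_isBlock_gate_ne hG hva
    obtain ⟨f, hf, hfB⟩ := hB B hB' haB
    refine ⟨f, v₀, hf, rfl, ?_⟩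
    have := not_connAvoiding_gate hG (hB'.pathConvex hG) hB'.nonempty (u := f) (v := v₀)
      (by rw [hfB]; exact hgB.symm)
    rwa [hfB] at this

variable {a : {a : V // G.IsArticulationPoint a}} {G' : G.Subgraph}

omit [Finite V] in
theorem Pruning.dist_le_dist_far (hG : G.Connected) (P : G.Pruning (.inl a) G')
    (H : G.articulationComponents (.inl a)) {v : V} (hv : v ∈ H.1.verts) :
    G.dist a.1 v ≤ G.dist a.1 (P.far H) := by
  have := P.le_far H v hv
  change G.distTo (G.singletonSubgraph a.1) v ≤ G.distTo (G.singletonSubgraph a.1) _ at this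
  rwa [distTo_singletonSubgraph, distTo_singletonSubgraph, ← hG.coe_dist, ← hG.coe_dist,
    Nat.cast_le] at this

theorem Pruning.connAvoiding_far (hG : G.Connected) (P : G.Pruning (.inl a) G')
    (H : G.articulationComponents (.inl a)) {v : V} (hv : v ∈ H.1.verts) (hva : v ≠ a.1) :
    G.ConnAvoiding a.1 v (P.far H) := by
  have h1 := P.dist_le_dist_far hG H hv
  have h2 := hG.pos_dist_of_ne hva.symm
  have hfar : P.far H ≠ a.1 := by
    intro h
    rw [h, G.dist_self] at h1
    omega
  exact (connAvoiding_iff_branchGraph_reachable hva).2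
    (branchGraph_reachable_of_mem_component hG H.2 hv (P.far_mem H) hva hfar)

/-- The central blocks of type A are all the blocks at `a`, so none may be lost. The far vertex of
the component containing `D` reaches `D` without passing `a`; hence its gate in `D` is not `a`, and
its geodesic uses an edge of `D`. -/
theorem Pruning.block_le_of_mem (hG : G.Connected) (P : G.Pruning (.inl a) G') {D : G.Subgraph}
    (hD : G.IsBlock D) (ha : a.1 ∈ D.verts) : D ≤ G' := by
  obtain ⟨H, hH, hDH⟩ := hD.exists_component (x := .inl a) (by simp)
  obtain ⟨w, hw, hwa⟩ : ∃ w ∈ D.verts, w ≠ a.1 := by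
    obtain ⟨E, F, hE, hF, hEF, haE, haF⟩ := (isArticulationPoint_iff_exists_isBlock hG).1 a.2
    by_cases h : D = E
    · exact hD.exists_ne hG hF (h ▸ hEF) haF
    · exact hD.exists_ne hG hE h haE
  obtain ⟨p, hp⟩ := P.connAvoiding_far hG ⟨H, hH⟩ (hDH hw) hwa
  refine P.block_le_of_gate_ne hG hD (H := ⟨H, hH⟩) fun h => hp ?_
  have hnear : P.near ⟨H, hH⟩ = a.1 := P.near_mem _
  rw [hnear, gate_of_mem hG (hD.pathConvex hG) ha] at h
  have := gate_mem_support hG (hD.pathConvex hG) hw p.reverse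
  rw [h] at this
  simpa using this

theorem Pruning.isBlockUnion_of_isArticulationPoint (hG : G.Connected)
    (P : G.Pruning (.inl a) G') : G'.IsBlockUnion := by
  refine P.isBlockUnion_of_forall_root hG fun v hv => ?_
  obtain ⟨D, hD, ha⟩ := exists_isBlock_mem hG a.1
  exact ⟨D, hD, P.block_le_of_mem hG hD ha, (show v = a.1 from hv) ▸ ha⟩

theorem Pruning.sameEccentricityData_of_isArticulationPoint (hG : G.Connected) (hA : G.IsTypeA)
    (ha : a.1 ∈ G.center) (P : G.Pruning (.inl a) G') : G.SameEccentricityData G' := by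
  obtain ⟨r, hr, f₁, f₂, h₁, h₂, hs⟩ := hA.exists_poles hG ha
  have hr0 : 0 < r := by
    obtain ⟨u, -, hu, -⟩ := (isArticulationPoint_iff hG).1 a.2
    exact (hG.pos_dist_of_ne hu.symm).trans_le (hr u)
  have key : ∀ f, G.dist a.1 f = r →
      ∃ f' ∈ G'.verts, G.dist a.1 f' = r ∧ G.ConnAvoiding a.1 f f' := by
    intro f hf
    have hfa : f ≠ a.1 := by
      rintro rfl
      rw [G.dist_self] at hf
      omega
    obtain ⟨D, hD, hfD⟩ := exists_isBlock_mem hG f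
    obtain ⟨H, hH, hDH⟩ := hD.exists_component (x := .inl a) (by simp)
    have h1 := P.dist_le_dist_far hG ⟨H, hH⟩ (hDH hfD)
    exact ⟨P.far ⟨H, hH⟩, P.far_mem_verts _, le_antisymm (hr _) (hf ▸ h1),
      P.connAvoiding_far hG ⟨H, hH⟩ (hDH hfD) hfa⟩
  obtain ⟨f₁', hf₁', h₁', hs₁⟩ := key f₁ h₁
  obtain ⟨f₂', hf₂', h₂', hs₂⟩ := key f₂ h₂
  exact sameEccentricityData_of_bipolar hG (P.isBlockUnion_of_isArticulationPoint hG) hr h₁' h₂'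
    (fun h => hs ((hs₁.trans h).trans hs₂.symm)) (P.root_le.1 rfl) hf₁' hf₂'
    fun D hD haD => P.block_le_of_mem hG hD haD

end TypeA

/-! ### Type B: domination as seen from the central block. -/

section TypeB

variable {B : {B : G.Subgraph // G.IsBlock B}} {G' : G.Subgraph}

theorem Pruning.isBlockUnion_of_isBlock (hG : G.Connected) (P : G.Pruning (.inr B) G') :
    G'.IsBlockUnion :=
  P.isBlockUnion_of_forall_root hG fun _ hv => ⟨B.1, B.2, P.root_le, hv⟩

/-- Every vertex is dominated, as seen from the block `B`, by a vertex of the pruned graph. -/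
theorem Pruning.exists_dominating (hG : G.Connected) (P : G.Pruning (.inr B) G') (v : V) :
    ∃ w ∈ G'.verts, G.gate B.1.verts w = G.gate B.1.verts v ∧
      G.dist (G.gate B.1.verts v) v ≤ G.dist (G.gate B.1.verts v) w := by
  by_cases hv : v ∈ B.1.verts
  · exact ⟨v, P.root_le.1 hv, rfl, le_rfl⟩
  · obtain ⟨D, hD, hvD⟩ := exists_isBlock_mem hG v
    obtain ⟨H, hH, hDH⟩ := hD.exists_component (x := .inr B) (by
      intro h
      cases h
      exact hv hvD)
    have hgate := gate_eq_of_branchGraph_reachable hG (branchGraph_reachable_of_mem_component hG hH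
      (P.far_mem ⟨H, hH⟩) (hDH hvD) (fun h => h) (fun h => h))
    have hle := P.le_far ⟨H, hH⟩ v (hDH hvD)
    change G.distTo B.1 v ≤ G.distTo B.1 _ at hle
    rw [distTo_eq hG B.2.nonempty, distTo_eq hG B.2.nonempty, Nat.cast_le, hgate] at hle
    exact ⟨P.far ⟨H, hH⟩, P.far_mem_verts _, hgate, hle⟩

omit [Finite V] in
theorem dist_eq_gate_add (hG : G.Connected) {S : Set V} (hS : G.PathConvex S) {c : V} (hc : c ∈ S)
    (v : V) : G.dist c v = G.dist c (G.gate S v) + G.dist (G.gate S v) v := by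
  have := dist_eq_add_gate hG hS (v := v) hc
  rw [G.dist_comm (u := v), G.dist_comm (u := v), G.dist_comm (v := c)] at this
  omega

theorem blockRadius_le_radius (hG : G.Connected) : G.blockRadius ≤ G.radius := by
  have := hG.nonempty
  obtain ⟨u, hu⟩ := G.exists_eccent_eq_radius
  obtain ⟨D, hD, huD⟩ := exists_isBlock_mem hG u
  rw [← hu]
  exact (blockRadius_le hD).trans
    (iSup_le fun v => (distTo_le_edist huD v).trans edist_le_eccent)

theorem Pruning.sameEccentricityData_of_isBlock (hG : G.Connected) (hA : ¬ G.IsTypeA)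
    (hB : B.1 ∈ G.centralBlocks) (P : G.Pruning (.inr B) G') : G.SameEccentricityData G' := by
  have hG' := P.isBlockUnion_of_isBlock hG
  have hBle : B.1 ≤ G' := P.root_le
  have hconv := B.2.pathConvex hG
  obtain ⟨v₀, hv₀⟩ := exists_distTo_eq_blockEccent hG B.1
  rw [distTo_eq hG B.2.nonempty] at hv₀
  set s := G.dist (G.gate B.1.verts v₀) v₀ with hs
  -- The block radius never exceeds the radius, so not being of type A means strict inequality;
  -- hence every vertex of `B` has eccentricity greater than `s`.
  have hsr : (s : ℕ∞) < G.radius := by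
    rw [hv₀, hB.2]
    exact (blockRadius_le_radius hG).lt_of_ne hA
  have hgs : ∀ v, G.dist (G.gate B.1.verts v) v ≤ s := by
    intro v
    have := distTo_le_blockEccent B.1 v
    rwa [← hv₀, distTo_eq hG B.2.nonempty, Nat.cast_le] at this
  have hc : ∀ c ∈ B.1.verts, ∃ w, s < G.dist c w := by
    intro c _
    obtain ⟨w, hw⟩ := exists_dist_eq_eccent hG c
    refine ⟨w, ?_⟩
    have := hsr.trans_le (radius_le_eccent (u := c))
    rwa [← hw, Nat.cast_lt] at this
  have hdom := P.exists_dominating hG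
  have hdom' : ∀ c ∈ B.1.verts, ∀ v, ∃ w ∈ G'.verts, G.dist c v ≤ G.dist c w := by
    intro c hc v
    obtain ⟨w, hw, hgw, hvw⟩ := hdom v
    refine ⟨w, hw, ?_⟩
    rw [dist_eq_gate_add hG hconv hc v, dist_eq_gate_add hG hconv hc w, hgw]
    omega
  obtain ⟨hcen, hbrad, hcb⟩ := center_subset_of_isBlock hG B.2 hv₀.symm hc
  have hecc : ∀ c (hc : c ∈ B.1.verts), G'.coe.eccent ⟨c, hBle.1 hc⟩ = G.eccent c := by
    intro c hc
    refine le_antisymm (hG'.eccent_coe_le hG _) ?_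
    rw [eccent_le_iff]
    intro v
    obtain ⟨w, hw, hvw⟩ := hdom' c hc v
    refine le_trans ?_ (edist_le_eccent (v := ⟨w, hw⟩))
    rw [hG'.edist_coe hG, ← hG.coe_dist, ← hG.coe_dist, Nat.cast_le]
    exact hvw
  have hBcoe := Subgraph.coeSubgraph_restrict_of_le hBle
  obtain ⟨hcen', hbrad', hcb'⟩ := center_subset_of_isBlock hG'.connected.coe
    (Subgraph.isBlock_restrict B.2 hBle) (s := s) (by
      apply le_antisymm
      · refine iSup_le fun v => ?_
        rw [hG'.distTo_coe hG, hBcoe, hv₀]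
        exact distTo_le_blockEccent B.1 v.1
      · obtain ⟨w, hw, hgw, hvw⟩ := hdom v₀
        refine le_trans ?_ (distTo_le_blockEccent _ ⟨w, hw⟩)
        rw [hG'.distTo_coe hG, hBcoe, distTo_eq hG B.2.nonempty, hgw, Nat.cast_le]
        exact hvw) (by
      intro c hcB
      obtain ⟨w, hw⟩ := hc c.1 hcB
      obtain ⟨w', hw', hww'⟩ := hdom' c.1 hcB w
      refine ⟨⟨w', hw'⟩, ?_⟩
      rw [hG'.dist_coe hG]
      exact hw.trans_le hww')
  have := hG.nonempty
  have := hG'.connected.coe.nonempty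
  have hrad : G'.coe.radius = G.radius := by
    apply le_antisymm
    · obtain ⟨x, hx⟩ := G.center_nonempty
      rw [← (G.mem_center_iff x).1 hx, ← hecc x (hcen hx)]
      exact radius_le_eccent
    · obtain ⟨x, hx⟩ := G'.coe.center_nonempty
      rw [← (G'.coe.mem_center_iff x).1 hx, hecc x.1 (hcen' hx)]
      exact radius_le_eccent
  refine ⟨?_, ?_, hrad, by rw [hbrad, hbrad'], le_antisymm (hG'.ediam_coe_le hG) ?_⟩
  · ext x
    constructor
    · rintro ⟨y, hy, rfl⟩
      rw [mem_center_iff, ← hrad, ← (G'.coe.mem_center_iff y).1 hy, hecc y.1 (hcen' hy)]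
    · intro hx
      refine ⟨⟨x, hBle.1 (hcen hx)⟩, ?_, rfl⟩
      rw [mem_center_iff, hrad, hecc x (hcen hx)]
      exact hx
  · rw [hcb, hcb', Set.image_singleton, hBcoe]
  · have hdiam : ∀ u v, u ∈ G'.verts → v ∈ G'.verts → (G.dist u v : ℕ∞) ≤ G'.coe.ediam := by
      intro u v hu hv
      rw [hG.coe_dist, ← hG'.edist_coe hG ⟨u, hu⟩ ⟨v, hv⟩]
      exact edist_le_ediam
    refine ediam_le_of_edist_le fun u v => ?_
    rw [← hG.coe_dist]
    obtain ⟨u', hu', hgu, huu⟩ := hdom u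
    -- If `u` and `v` share the gate `g`, then `d(u, v) ≤ d(g, u) + s`. A vertex `w` with `d(g, w) >
    -- s` has another gate, so the retained vertices dominating `u` and `w` are farther apart than
    -- `u` and `v`. If the gates differ, the vertices dominating `u` and `v` suffice.
    by_cases hne : G.gate B.1.verts u = G.gate B.1.verts v
    · obtain ⟨w, hw⟩ := hc (G.gate B.1.verts u) (gate_mem B.2.nonempty u)
      obtain ⟨w', hw', hgw, hww⟩ := hdom w
      refine le_trans ?_ (hdiam u' w' hu' hw')
      rw [Nat.cast_le]
      have h1 := dist_eq_gate_add hG hconv (G.gate_mem B.2.nonempty u) w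
      have h2 := hgs v
      have h3 := hgs w
      have h4 : G.gate B.1.verts u' ≠ G.gate B.1.verts w' := by
        rw [hgu, hgw]
        intro h
        rw [← h, G.dist_self] at h1
        rw [← h] at h3
        omega
      have h5 := dist_eq_of_gate_ne hG hconv B.2.nonempty h4
      rw [hgu, hgw] at h5
      have h6 := hG.dist_triangle (u := u) (v := G.gate B.1.verts u) (w := v)
      rw [G.dist_comm (u := u) (v := G.gate B.1.verts u)] at h6
      rw [← hne] at h2
      omega
    · obtain ⟨v', hv', hgv, hvv⟩ := hdom v
      refine le_trans ?_ (hdiam u' v' hu' hv')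
      rw [Nat.cast_le, dist_eq_of_gate_ne hG hconv B.2.nonempty hne,
        dist_eq_of_gate_ne hG hconv B.2.nonempty (u := u') (v := v') (by rwa [hgu, hgv]), hgu, hgv]
      omega

end TypeB

/-! ### The degenerate one-vertex case and the conclusion. -/

section Assembly

theorem isPathShaped_of_subsingleton [Subsingleton V] (hG : G.Connected) :
    G.bcTree.IsPathShaped := by
  refine (bcTree_isTree hG).isPathShaped fun t ht => ?_
  have hart : ∀ a, ¬ G.IsArticulationPoint a := by
    intro a ha
    obtain ⟨u, -, hu, -⟩ := (isArticulationPoint_iff hG).1 ha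
    exact hu (Subsingleton.elim _ _)
  obtain ⟨u, -, -, hu, -⟩ := two_lt_encard_iff.1 ht
  rw [mem_neighborSet] at hu
  rcases t with a | B
  · exact hart _ a.2
  rcases u with a | B
  · exact hart _ a.2
  · exact hu

omit [Finite V] in
theorem Subgraph.le_of_subsingleton [Subsingleton V] {D H : G.Subgraph} (hH : H.verts.Nonempty) :
    D ≤ H := by
  obtain ⟨a, ha⟩ := hH
  exact ⟨fun v _ => Subsingleton.elim a v ▸ ha, fun u v h => (h.ne (Subsingleton.elim u v)).elim⟩

theorem Subgraph.isBlockUnion_of_subsingleton [Subsingleton V] (hG : G.Connected)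
    {H : G.Subgraph} (hH : H.verts.Nonempty) : H.IsBlockUnion := by
  refine ⟨?_, fun v _ => ?_, fun u v h => (h.ne (Subsingleton.elim u v)).elim⟩
  · rw [Subgraph.connected_iff_forall_exists_walk_subgraph]
    refine ⟨hH, fun {u v} _ _ => ?_⟩
    obtain rfl := Subsingleton.elim u v
    exact ⟨.nil, Subgraph.le_of_subsingleton hH⟩
  · obtain ⟨D, hD, hv⟩ := exists_isBlock_mem hG v
    exact ⟨D, hD, Subgraph.le_of_subsingleton hH, hv⟩

theorem IsPruning.properties (hG : G.Connected) {G' : G.Subgraph} (h : G.IsPruning G') :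
    G'.IsBlockUnion ∧ (G'.coe.bcTree.IsPathShaped ∨ G'.coe.bcTree.IsStarlike) ∧
      G.SameEccentricityData G' := by
  rcases h with ⟨hA, a, ha, h⟩ | ⟨hA, B, hB, h⟩
  · by_cases hart : G.IsArticulationPoint a
    · have hcomps : G.articulationComponentsAtPoint a =
          G.articulationComponents (.inl ⟨a, hart⟩) :=
        Set.ext fun H => ⟨fun ⟨_, hH⟩ => hH, fun hH => ⟨hart, hH⟩⟩
      rw [hcomps] at h
      obtain ⟨P⟩ := IsPrunedAlong.exists_pruning (x := .inl ⟨a, hart⟩) h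
      have hG' := P.isBlockUnion_of_isArticulationPoint hG
      exact ⟨hG', P.isPathShaped_or_isStarlike hG hG',
        P.sameEccentricityData_of_isArticulationPoint hG hA ha⟩
    · obtain ⟨r, hr, f₁, f₂, h₁, h₂, hs⟩ := hA.exists_poles hG ha
      -- Poles at positive distance would make `a` an articulation point. So the case without
      -- components at `a` is the one-vertex graph.
      have hr0 : r = 0 := by
        by_contra hr0
        refine hart ((isArticulationPoint_iff hG).2 ⟨f₁, f₂, ?_, ?_, hs⟩)
        · rintro rfl
          exact hr0 (h₁ ▸ G.dist_self)
        · rintro rfl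
          exact hr0 (h₂ ▸ G.dist_self)
      have hall : ∀ v, a = v := fun v => hG.dist_eq_zero_iff.1 (by have := hr v; omega)
      have : Subsingleton V := ⟨fun u v => (hall u).symm.trans (hall v)⟩
      have haG' : a ∈ G'.verts := by
        obtain ⟨_, _, _, _, _, rfl⟩ := h
        exact .inl rfl
      have hG' := Subgraph.isBlockUnion_of_subsingleton hG ⟨a, haG'⟩
      exact ⟨hG', .inl (isPathShaped_of_subsingleton hG'.connected.coe),
        sameEccentricityData_of_bipolar hG hG' hr h₁ h₂ hs haG' (hall f₁ ▸ haG') (hall f₂ ▸ haG')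
          fun D _ _ => Subgraph.le_of_subsingleton ⟨a, haG'⟩⟩
  · have hcomps : G.articulationComponentsAtBlock B = G.articulationComponents (.inr ⟨B, hB.1⟩) :=
      Set.ext fun H => ⟨fun ⟨_, hH⟩ => hH, fun hH => ⟨hB.1, hH⟩⟩
    rw [hcomps] at h
    obtain ⟨P⟩ := IsPrunedAlong.exists_pruning (x := .inr ⟨B, hB.1⟩) h
    have hG' := P.isBlockUnion_of_isBlock hG
    exact ⟨hG', P.isPathShaped_or_isStarlike hG hG', P.sameEccentricityData_of_isBlock hG hA hB⟩

end Assembly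

end SimpleGraph

theorem theorem5p2 {V : Type*} [Finite V] (G : SimpleGraph V) (hG : G.Connected) :
    (∃ G' : G.Subgraph, G.IsPruning G') ∧
    ∀ G' : G.Subgraph, G.IsPruning G' →
      G'.Connected ∧
      G.BCTreeIsSubgraph G' ∧
      (G'.coe.bcTree.IsPathShaped ∨ G'.coe.bcTree.IsStarlike) ∧
      (Subtype.val '' G'.coe.center = G.center ∧
        SimpleGraph.Subgraph.coeSubgraph '' G'.coe.centralBlocks = G.centralBlocks ∧
        G'.coe.radius = G.radius ∧
        G'.coe.blockRadius = G.blockRadius) ∧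
      (Subtype.val '' G'.coe.periphery ⊆ G.periphery ∧
        G'.coe.ediam = G.ediam) := by
  refine ⟨SimpleGraph.exists_isPruning hG, fun G' h => ?_⟩
  obtain ⟨hG', hshape, hdata⟩ := h.properties hG
  exact ⟨hG'.connected, hG'.bcTreeIsSubgraph hG, hshape,
    ⟨hdata.center, hdata.centralBlocks, hdata.radius, hdata.blockRadius⟩,
    hG'.periphery_coe_subset hG hdata.ediam, hdata.ediam⟩
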